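/- Let $p, m$ be integers with $m \ge p \ge 0$ and let $\Sigma$ be a real symmetric positive definite $p\times p$ matrix. Let $W \sim W_p(m,\Sigma)$, i.e. $W$ is a random matrix with the law of $\sum_{i=1}^m X_i X_i^\top$, where $X_1,\dots,X_m$ are i.i.d. $N_p(0,\Sigma)$ random vectors. Let $V = W^{1/2}$ be its symmetric (positive semidefinite) square root; where $W$ is positive definite, this is the unique positive definite matrix with $V^2 = W$. Then $V$ has a density with respect to the Lebesgue measure $\prod_{1\le i\le j\le p} dv_{ij}$ on the space of real symmetric $p\times p$ matrices, and this density is $$ f(V) = \frac{2^p}{2^{mp/2}\,\Gamma_p(m/2)\,|\Sigma|^{m/2}}\,|V|^{m-p}\exp\!\Big(-\tfrac12 \operatorname{tr}(\Sigma^{-1}V^2)\Big)\prod_{1\le i<j\le p}(\delta_i+\delta_j) $$ for $V$ positive definite, and $f(V)=0$ otherwise. Here $\delta_1,\dots,\delta_p$ are the eigenvalues of $V$ counted with multiplicity, $|\cdot|$ is the determinant, and $\Gamma_p(a)=\pi^{p(p-1)/4}\prod_{i=1}^p\Gamma\big(a-\tfrac{i-1}{2}\big)$ is the multivariate Gamma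 function. -/

import Mathlib

open MeasureTheory ProbabilityTheory
open scoped MatrixOrder

noncomputable section

namespace WishartSqrt

/-- The product `σ`-algebra (generated by the entries) on real matrices. -/
instance instMeasurableSpaceMatrix (p : ℕ) : MeasurableSpace (Matrix (Fin p) (Fin p) ℝ) :=
  inferInstanceAs (MeasurableSpace (Fin p → Fin p → ℝ))

/-- The Wishart distribution `W_p(m, S)`: the law of `∑ i, X i (X i)ᵀ`, where `X 1, …, X m` are
i.i.d. centred Gaussian vectors in `ℝ^p` with covariance matrix `S`. -/
def wishart (p m : ℕ) (S : Matrix (Fin p) (Fin p) ℝ) : Measure (Matrix (Fin p) (Fin p) ℝ) :=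
  (Measure.pi fun _ : Fin m => multivariateGaussian (0 : EuclideanSpace ℝ (Fin p)) S).map
    fun x => ∑ i, Matrix.vecMulVec (x i).ofLp (x i).ofLp

/-- The symmetric matrix with prescribed entries on and above the diagonal. -/
def symOfUpper (p : ℕ) (x : {ij : Fin p × Fin p // ij.1 ≤ ij.2} → ℝ) :
    Matrix (Fin p) (Fin p) ℝ :=
  Matrix.of fun i j => x ⟨(min i j, max i j), min_le_max⟩

/-- Lebesgue measure `∏_{i ≤ j} dv_{ij}` on symmetric matrices, as a measure on all
`p × p` matrices carried by the symmetric ones. -/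
def symLebesgue (p : ℕ) : Measure (Matrix (Fin p) (Fin p) ℝ) :=
  (volume : Measure ({ij : Fin p × Fin p // ij.1 ≤ ij.2} → ℝ)).map (symOfUpper p)

/-- The multivariate Gamma function
`Γ_p(a) = π^{p(p-1)/4} ∏_{i=1}^p Γ(a - (i-1)/2)` (here `i` runs over `0, …, p-1`). -/
def multivariateGamma (p : ℕ) (a : ℝ) : ℝ :=
  Real.pi ^ ((p : ℝ) * ((p : ℝ) - 1) / 4) * ∏ i : Fin p, Real.Gamma (a - (i : ℝ) / 2)

open Classical in
/-- The claimed density of the square root of a `W_p(m, S)` matrix, at the matrix `V`;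
it vanishes off the positive definite matrices. -/
def sqrtDensity (p m : ℕ) (S V : Matrix (Fin p) (Fin p) ℝ) : ℝ :=
  if hV : V.PosDef then
    (2 : ℝ) ^ p /
        ((2 : ℝ) ^ ((m : ℝ) * (p : ℝ) / 2) * multivariateGamma p ((m : ℝ) / 2) *
          S.det ^ ((m : ℝ) / 2)) *
      V.det ^ ((m : ℝ) - (p : ℝ)) *
      Real.exp (-(1 / 2) * (S⁻¹ * V ^ 2).trace) *
      ∏ ij : Fin p × Fin p with ij.1 < ij.2,
        (hV.isHermitian.eigenvalues ij.1 + hV.isHermitian.eigenvalues ij.2)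
  else 0

/-- On positive definite matrices `CFC.sqrt` is the symmetric square root: the unique positive
definite matrix whose square is the given one. -/
theorem eq_sqrt_iff {p : ℕ} {A B : Matrix (Fin p) (Fin p) ℝ} (hA : A.PosDef) :
    B = CFC.sqrt A ↔ B.PosDef ∧ B ^ 2 = A := by
  have hA0 : 0 ≤ A := hA.posSemidef.nonneg
  constructor
  · rintro rfl
    refine ⟨(Matrix.isStrictlyPositive_iff_posDef).1 ?_, CFC.sq_sqrt A⟩
    exact (Matrix.isStrictlyPositive_iff_posDef.2 hA).sqrt
  · rintro ⟨hB, h⟩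
    exact ((CFC.sqrt_eq_iff A B hA0 hB.posSemidef.nonneg).2 (by rw [← h, sq])).symm

end WishartSqrt

end

/-! Let X be the p × m matrix with columns X_i. Then W = X Xᵀ is the Gram matrix of the p rows of X
in ℝ^m, and the Gaussian density of X depends on X only through W, via tr(S⁻¹W). So the law of W
follows from the push-forward of Lebesgue measure under the Gram map, which is `gramConst p m` ·
|W|^((m-p-1)/2) dW on positive definite matrices (`lintegral_gram`, `lintegral_wishart`).

The Gram formula goes by induction on p. Given p independent vectors with Gram matrix W, a further
vector is described by its inner products w with them and its squared distance s to their span. The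
span contributes dw/√|W|; its orthogonal complement, of dimension k = m - p, contributes a multiple
of s^(k/2-1) ds (`lintegral_inner_norm_sq`). The enlarged Gram matrix has determinant |W|s by the
Schur complement (`det_border`), and all powers of |W| then cancel (`detPow_mul_borderIntegral`).

Finally V ↦ V² is a bijection of the positive definite cone onto itself, with derivative H ↦ VH +
HV. In an eigenbasis of V the derivative multiplies the (i,j) entry by δ_i + δ_j, so the Jacobian is
∏_{i≤j}(δ_i+δ_j) = 2^p |V| ∏_{i<j}(δ_i+δ_j) (`det_lyapunov`). Together with |V²|^((m-p-1)/2) this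
gives the power |V|^(m-p). -/

namespace WishartSqrt

/-! ### Radial integrals and the law of the squared norm. -/

section Radial

variable {E : Type*} [NormedAddCommGroup E] [InnerProductSpace ℝ E] [FiniteDimensional ℝ E]
  [MeasurableSpace E] [BorelSpace E]

/-- Polar coordinates for the lower Lebesgue integral of a radial function. -/
theorem lintegral_fun_norm [Nontrivial E] (f : ℝ → ENNReal) (hf : Measurable f) :
    ∫⁻ z : E, f ‖z‖ = (Module.finrank ℝ E * volume (Metric.ball (0 : E) 1)) *
      ∫⁻ r in Set.Ioi (0 : ℝ), ENNReal.ofReal (r ^ (Module.finrank ℝ E - 1)) * f r := by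
  calc ∫⁻ z : E, f ‖z‖
      = ∫⁻ z : ({(0)}ᶜ : Set E), f ‖z.1‖ ∂(volume.comap Subtype.val) := by
        rw [lintegral_subtype_comap (measurableSet_singleton _).compl (fun z : E ↦ f ‖z‖),
          restrict_compl_singleton]
    _ = ∫⁻ z, f z.2 ∂(volume : Measure E).toSphere.prod
          (.volumeIoiPow (Module.finrank ℝ E - 1)) := by
        simpa using (volume : Measure E).measurePreserving_homeomorphUnitSphereProd.lintegral_comp_emb
          (Homeomorph.measurableEmbedding _) (f ∘ Subtype.val ∘ Prod.snd)
    _ = (volume : Measure E).toSphere Set.univ *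
          ∫⁻ r : Set.Ioi (0 : ℝ), f r ∂.volumeIoiPow (Module.finrank ℝ E - 1) := by
        rw [lintegral_prod _ (by fun_prop)]
        simp [mul_comm]
    _ = _ := by
        rw [Measure.toSphere_apply_univ, Measure.volumeIoiPow,
          lintegral_withDensity_eq_lintegral_mul _ (by fun_prop) (by fun_prop)]
        congr 1
        exact lintegral_subtype_comap measurableSet_Ioi
          (fun r : ℝ ↦ ENNReal.ofReal (r ^ (Module.finrank ℝ E - 1)) * f r)

/-- Substitution s = r², ds = 2r dr, using r^(k-1) = ½ · 2r · (r²)^(k/2-1). Positivity of `k` makes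
the truncated `k - 1` the true difference. -/
theorem lintegral_Ioi_comp_sq (g : ℝ → ENNReal) (k : ℕ) (hk : 0 < k) :
    ∫⁻ r in Set.Ioi (0 : ℝ), ENNReal.ofReal (r ^ (k - 1)) * g (r ^ 2) =
      ENNReal.ofReal (1 / 2) *
        ∫⁻ s in Set.Ioi (0 : ℝ), ENNReal.ofReal (s ^ ((k : ℝ) / 2 - 1)) * g s := by
  have himg : (fun r : ℝ ↦ r ^ 2) '' Set.Ioi 0 = Set.Ioi 0 := by
    ext s
    simp only [Set.mem_image, Set.mem_Ioi]
    constructor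
    · rintro ⟨r, hr, rfl⟩; positivity
    · intro hs; exact ⟨√s, Real.sqrt_pos.2 hs, Real.sq_sqrt hs.le⟩
  have hinj : Set.InjOn (fun r : ℝ ↦ r ^ 2) (Set.Ioi 0) := fun a ha b hb h ↦
    (pow_left_inj₀ (le_of_lt ha) (le_of_lt hb) two_ne_zero).1 h
  have key := lintegral_image_eq_lintegral_abs_deriv_mul (f' := fun r ↦ 2 * r) measurableSet_Ioi
    (fun r _ ↦ by simpa using (hasDerivAt_pow 2 r).hasDerivWithinAt) hinj
    (fun s ↦ ENNReal.ofReal (s ^ ((k : ℝ) / 2 - 1)) * g s)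
  rw [himg] at key
  rw [key, ← lintegral_const_mul' _ _ ENNReal.ofReal_ne_top]
  refine setLIntegral_congr_fun measurableSet_Ioi fun r (hr : 0 < r) ↦ ?_
  rw [← mul_assoc, ← mul_assoc, ← ENNReal.ofReal_mul (by positivity),
    ← ENNReal.ofReal_mul (by positivity)]
  congr 2
  rw [← Real.rpow_natCast r 2, ← Real.rpow_mul hr.le, abs_of_pos (by positivity : 0 < 2 * r),
    ← Real.rpow_natCast r (k - 1), Nat.cast_pred hk]
  have : ((2 : ℕ) : ℝ) * ((k : ℝ) / 2 - 1) = ((k : ℝ) - 1) - 1 := by push_cast; ring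
  rw [this, Real.rpow_sub hr ((k : ℝ) - 1) 1, Real.rpow_one]
  field_simp

/-- The squared norm pushes Lebesgue measure in dimension `k > 0` to
`π^(k/2) / Γ(k/2) s^(k/2-1) ds` on the positive half-line. -/
theorem lintegral_fun_norm_sq {k : ℕ} (hE : Module.finrank ℝ E = k) (hk : 0 < k)
    (g : ℝ → ENNReal) (hg : Measurable g) :
    ∫⁻ z : E, g (‖z‖ ^ 2) = ENNReal.ofReal (Real.pi ^ ((k : ℝ) / 2) / Real.Gamma ((k : ℝ) / 2)) *
      ∫⁻ s in Set.Ioi (0 : ℝ), ENNReal.ofReal (s ^ ((k : ℝ) / 2 - 1)) * g s := by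
  have : Nontrivial E := Module.nontrivial_of_finrank_pos (R := ℝ) (hE ▸ hk)
  have hk' : (0 : ℝ) < k := by exact_mod_cast hk
  rw [lintegral_fun_norm (fun r ↦ g (r ^ 2)) (by fun_prop), hE, lintegral_Ioi_comp_sq g k hk,
    ← mul_assoc]
  congr 1
  -- The constant is k · vol(ball) · ½ = (k/2) π^(k/2) / Γ(k/2 + 1), where Γ(k/2 + 1) = (k/2)
  -- Γ(k/2).
  rw [InnerProductSpace.volume_ball, hE, ENNReal.ofReal_one, one_pow, one_mul,
    ← ENNReal.ofReal_natCast, ← ENNReal.ofReal_mul (by positivity),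
    ← ENNReal.ofReal_mul (by positivity)]
  congr 1
  have h2 : √Real.pi ^ k = Real.pi ^ ((k : ℝ) / 2) := by
    rw [Real.sqrt_eq_rpow, ← Real.rpow_natCast, ← Real.rpow_mul Real.pi_pos.le]
    congr 1; ring
  rw [Real.Gamma_add_one (by positivity), h2]
  field_simp
end Radial

/-! ### Adding one vector to a linearly independent family. -/

section Step

open scoped Matrix

variable {E : Type*} [NormedAddCommGroup E] [InnerProductSpace ℝ E] [FiniteDimensional ℝ E]
  [MeasurableSpace E] [BorelSpace E]

/-- Used with A Aᵀ a Gram matrix, and again with A Aᵀ a covariance matrix. -/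
theorem mulVec_dotProduct_inv_mulVec {p : ℕ} {A : Matrix (Fin p) (Fin p) ℝ} (hA : A.det ≠ 0)
    (u : Fin p → ℝ) : (A *ᵥ u) ⬝ᵥ (A * Aᵀ)⁻¹ *ᵥ (A *ᵥ u) = u ⬝ᵥ u := by
  have hAu : IsUnit A.det := hA.isUnit
  rw [Matrix.mul_inv_rev, ← Matrix.mulVec_mulVec, Matrix.mulVec_mulVec _ A⁻¹ A,
    Matrix.nonsing_inv_mul _ hAu, Matrix.one_mulVec, Matrix.dotProduct_mulVec,
    ← Matrix.mulVec_transpose, Matrix.mulVec_mulVec, Matrix.transpose_nonsing_inv,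
    Matrix.transpose_transpose, Matrix.nonsing_inv_mul _ hAu, Matrix.one_mulVec]

/-- Linear change of variables by an invertible matrix, on Euclidean space. -/
theorem lintegral_comp_mulVec {p : ℕ} (A : Matrix (Fin p) (Fin p) ℝ) (hA : A.det ≠ 0)
    (G : (Fin p → ℝ) → ENNReal) (hG : Measurable G) :
    ∫⁻ u : EuclideanSpace ℝ (Fin p), G (A *ᵥ u.ofLp) = ENNReal.ofReal |A.det⁻¹| * ∫⁻ w, G w := by
  have h2 : Measurable (Matrix.toLin' A) :=
    (LinearMap.continuous_of_finiteDimensional _).measurable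
  have h1 := (PiLp.volume_preserving_ofLp (Fin p)).lintegral_comp (f := fun u ↦ G (A *ᵥ u))
    (hG.comp h2)
  have h3 : ∫⁻ u, G (A *ᵥ u) = ∫⁻ u, G u ∂(volume.map (Matrix.toLin' A)) := by
    rw [lintegral_map hG h2]; rfl
  rw [h1, h3, Real.map_matrix_volume_pi_eq_smul_volume_pi hA, lintegral_smul_measure, smul_eq_mul]

/-- The joint law under Lebesgue measure of the inner products with `p` independent vectors and of
the squared norm, in terms of the Gram matrix of the vectors. -/
theorem lintegral_inner_norm_sq {p k : ℕ} (hE : Module.finrank ℝ E = p + k) (hk : 0 < k)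
    {x : Fin p → E} (hx : LinearIndependent ℝ x) (H : (Fin p → ℝ) → ℝ → ENNReal)
    (hH : Measurable (Function.uncurry H)) :
    ∫⁻ y : E, H (fun i ↦ inner ℝ (x i) y) (‖y‖ ^ 2) =
      ENNReal.ofReal (Real.pi ^ ((k : ℝ) / 2) / Real.Gamma ((k : ℝ) / 2)) *
        (ENNReal.ofReal (√(Matrix.gram ℝ x).det)⁻¹ *
          ∫⁻ w, ∫⁻ s in Set.Ioi (0 : ℝ), ENNReal.ofReal (s ^ ((k : ℝ) / 2 - 1)) *
            H w (w ⬝ᵥ (Matrix.gram ℝ x)⁻¹ *ᵥ w + s)) := by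
  set K := Submodule.span ℝ (Set.range x) with hK
  have hKp : Module.finrank ℝ K = p := by
    simpa using finrank_span_eq_card hx
  have hKk : Module.finrank ℝ Kᗮ = k := by
    have := K.finrank_add_finrank_orthogonal
    omega
  have hxK (i : Fin p) : x i ∈ K := Submodule.subset_span ⟨i, rfl⟩
  -- The rows of `A` are the coordinates of the `x i` in an orthonormal basis of their span. A
  -- vector with span coordinates u has inner products A u, and the Gram matrix is A Aᵀ, so |det A|
  -- = √(det gram) is the Jacobian of u ↦ w.
  let b : OrthonormalBasis (Fin p) ℝ K := (stdOrthonormalBasis ℝ K).reindex (finCongr hKp)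
  let A : Matrix (Fin p) (Fin p) ℝ := Matrix.of fun i ↦ (b.repr ⟨x i, hxK i⟩).ofLp
  have hinner (i : Fin p) (u : K) (v : Kᗮ) :
      inner ℝ (x i) ((u : E) + v) = (A *ᵥ (b.repr u).ofLp) i := by
    rw [inner_add_right, Submodule.inner_right_of_mem_orthogonal (hxK i) v.2, add_zero]
    have : inner ℝ (x i) (u : E) = inner ℝ (⟨x i, hxK i⟩ : K) u := rfl
    rw [this, ← b.repr.inner_map_map, PiLp.inner_apply]
    simp [A, Matrix.mulVec, dotProduct, mul_comm]
  have hgram : Matrix.gram ℝ x = A * Aᵀ := by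
    ext i j
    have := hinner i ⟨x j, hxK j⟩ 0
    simp only [ZeroMemClass.coe_zero, add_zero] at this
    rw [Matrix.gram_apply, this]
    simp [A, Matrix.mulVec, dotProduct, Matrix.mul_apply]
  have hdet : (Matrix.gram ℝ x).det = A.det ^ 2 := by
    rw [hgram, Matrix.det_mul, Matrix.det_transpose, sq]
  have hA : A.det ≠ 0 := by
    have := (Matrix.posDef_gram_of_linearIndependent hx).det_pos
    intro h
    simp [hdet, h] at this
  have hquad (u : Fin p → ℝ) : (A *ᵥ u) ⬝ᵥ (Matrix.gram ℝ x)⁻¹ *ᵥ (A *ᵥ u) = u ⬝ᵥ u := by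
    rw [hgram, mulVec_dotProduct_inv_mulVec hA]
  have hnorm (u : K) (v : Kᗮ) : ‖(u : E) + v‖ ^ 2 =
      (b.repr u).ofLp ⬝ᵥ (b.repr u).ofLp + ‖v‖ ^ 2 := by
    have h0 : inner ℝ (u : E) (v : E) = 0 := Submodule.inner_right_of_mem_orthogonal u.2 v.2
    have h1 : ‖(u : E)‖ ^ 2 = (b.repr u).ofLp ⬝ᵥ (b.repr u).ofLp := by
      rw [← Submodule.coe_norm, ← b.repr.norm_map, EuclideanSpace.real_norm_sq_eq]
      simp [dotProduct, sq]
    rw [sq, norm_add_sq_eq_norm_sq_add_norm_sq_real h0, ← sq, ← sq, h1, ← Submodule.coe_norm]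
  let G : (Fin p → ℝ) → ENNReal := fun w ↦ ∫⁻ s in Set.Ioi (0 : ℝ),
    ENNReal.ofReal (s ^ ((k : ℝ) / 2 - 1)) * H w (w ⬝ᵥ (Matrix.gram ℝ x)⁻¹ *ᵥ w + s)
  have hq : Measurable fun w : Fin p → ℝ ↦ w ⬝ᵥ (Matrix.gram ℝ x)⁻¹ *ᵥ w :=
    (by fun_prop : Continuous fun w : Fin p → ℝ ↦ w ⬝ᵥ (Matrix.gram ℝ x)⁻¹ *ᵥ w).measurable
  have hHm {α : Type _} [MeasurableSpace α] {f : α → Fin p → ℝ} {g : α → ℝ} (hf : Measurable f)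
      (hg : Measurable g) : Measurable fun a ↦ H (f a) (g a) := hH.comp (hf.prodMk hg)
  have hG : Measurable G := by
    refine Measurable.lintegral_prod_right' (f := fun z : (Fin p → ℝ) × ℝ ↦
      ENNReal.ofReal (z.2 ^ ((k : ℝ) / 2 - 1)) *
        H z.1 (z.1 ⬝ᵥ (Matrix.gram ℝ x)⁻¹ *ᵥ z.1 + z.2)) ?_
    exact Measurable.mul (by fun_prop) (hHm measurable_fst ((hq.comp measurable_fst).add
      measurable_snd))
  have hF : Measurable fun z : K × Kᗮ ↦
      H (A *ᵥ (b.repr z.1).ofLp) ((b.repr z.1).ofLp ⬝ᵥ (b.repr z.1).ofLp + ‖z.2‖ ^ 2) := by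
    have h1 : Continuous fun z : K × Kᗮ ↦ A *ᵥ (b.repr z.1).ofLp :=
      continuous_const.matrix_mulVec (by fun_prop)
    have h2 : Continuous fun z : K × Kᗮ ↦
      (b.repr z.1).ofLp ⬝ᵥ (b.repr z.1).ofLp + ‖z.2‖ ^ 2 := by fun_prop
    exact hH.comp (h1.measurable.prodMk h2.measurable)
  calc ∫⁻ y : E, H (fun i ↦ inner ℝ (x i) y) (‖y‖ ^ 2)
      = ∫⁻ z : WithLp 2 (K × Kᗮ), H (fun i ↦ inner ℝ (x i) (K.orthogonalDecomposition.symm z))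
          (‖K.orthogonalDecomposition.symm z‖ ^ 2) := by
        symm
        exact K.orthogonalDecomposition.symm.measurePreserving.lintegral_comp_emb
          K.orthogonalDecomposition.symm.toHomeomorph.measurableEmbedding
          (fun y ↦ H (fun i ↦ inner ℝ (x i) y) (‖y‖ ^ 2))
    _ = ∫⁻ z : K × Kᗮ,
          H (A *ᵥ (b.repr z.1).ofLp) ((b.repr z.1).ofLp ⬝ᵥ (b.repr z.1).ofLp + ‖z.2‖ ^ 2) := by
        rw [← (WithLp.volume_preserving_ofLp K Kᗮ).lintegral_comp hF]
        refine lintegral_congr fun z ↦ ?_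
        rw [Submodule.orthogonalDecomposition_symm_apply, hnorm]
        simp only [hinner]
        rfl
    _ = ∫⁻ u : K, ∫⁻ v : Kᗮ,
          H (A *ᵥ (b.repr u).ofLp) ((b.repr u).ofLp ⬝ᵥ (b.repr u).ofLp + ‖v‖ ^ 2) := by
        rw [Measure.volume_eq_prod, lintegral_prod _ hF.aemeasurable]
    _ = ∫⁻ u : K, ENNReal.ofReal (Real.pi ^ ((k : ℝ) / 2) / Real.Gamma ((k : ℝ) / 2)) *
          G (A *ᵥ (b.repr u).ofLp) := by
        refine lintegral_congr fun u ↦ ?_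
        rw [lintegral_fun_norm_sq hKk hk
          (fun s ↦ H (A *ᵥ (b.repr u).ofLp) ((b.repr u).ofLp ⬝ᵥ (b.repr u).ofLp + s))
          (hHm measurable_const (by fun_prop))]
        simp only [G, hquad]
    _ = _ := by
        rw [lintegral_const_mul' _ _ ENNReal.ofReal_ne_top,
          b.measurePreserving_repr.lintegral_comp (f := fun u ↦ G (A *ᵥ u.ofLp))
            (hG.comp (continuous_const.matrix_mulVec (by fun_prop)).measurable),
          lintegral_comp_mulVec A hA G hG, hdet, Real.sqrt_sq_eq_abs, abs_inv]

end Step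

/-! ### Bordered matrices and the Schur complement. -/

section Border

open scoped Matrix

instance instBorelSpaceMatrix (p : ℕ) : BorelSpace (Matrix (Fin p) (Fin p) ℝ) :=
  inferInstanceAs (BorelSpace (Fin p → Fin p → ℝ))

theorem measurable_entry {p : ℕ} (i j : Fin p) :
    Measurable fun M : Matrix (Fin p) (Fin p) ℝ ↦ M i j :=
  (continuous_id.matrix_elem i j).measurable

theorem measurable_matrix {α : Type*} [MeasurableSpace α] {p : ℕ}
    {f : α → Matrix (Fin p) (Fin p) ℝ} (h : ∀ i j, Measurable fun a ↦ f a i j) : Measurable f :=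
  measurable_pi_lambda _ fun i ↦ measurable_pi_lambda _ fun j ↦ h i j

theorem measurable_det (p : ℕ) : Measurable (Matrix.det : Matrix (Fin p) (Fin p) ℝ → ℝ) :=
  (continuous_id.matrix_det).measurable

/-- Semidefiniteness is a closed condition, and a semidefinite matrix is definite exactly when its
determinant is nonzero. -/
theorem measurableSet_posDef (p : ℕ) : MeasurableSet {M : Matrix (Fin p) (Fin p) ℝ | M.PosDef} := by
  have hclosed : IsClosed {M : Matrix (Fin p) (Fin p) ℝ | M.PosSemidef} := by
    simp only [Matrix.posSemidef_iff_dotProduct_mulVec, Set.ofPred_and, Set.ofPred_forall]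
    refine IsClosed.inter (isClosed_eq continuous_id.matrix_conjTranspose continuous_id)
      (isClosed_iInter fun x ↦ isClosed_le continuous_const ?_)
    exact continuous_const.dotProduct (continuous_id.matrix_mulVec continuous_const)
  have : {M : Matrix (Fin p) (Fin p) ℝ | M.PosDef} =
      {M | M.PosSemidef} ∩ {M | M.det ≠ 0} := by
    ext M
    exact ⟨fun h ↦ ⟨h.posSemidef, h.det_pos.ne'⟩, fun h ↦ h.1.posDef_iff_det_ne_zero.2 h.2⟩
  rw [this]
  exact hclosed.measurableSet.inter
    ((measurable_det p) (measurableSet_singleton (0 : ℝ)).compl)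

/-- The symmetric matrix obtained from `W` by adding a first row and column with corner `r` and
off-diagonal part `w`. -/
def border {p : ℕ} (W : Matrix (Fin p) (Fin p) ℝ) (w : Fin p → ℝ) (r : ℝ) :
    Matrix (Fin (p + 1)) (Fin (p + 1)) ℝ :=
  Matrix.of (Fin.cons (Fin.cons r w) fun i ↦ Fin.cons (w i) (W i))

variable {p : ℕ} (W : Matrix (Fin p) (Fin p) ℝ) (w : Fin p → ℝ) (r : ℝ)

@[simp] theorem border_zero_zero : border W w r 0 0 = r := rfl

@[simp] theorem border_zero_succ (j : Fin p) : border W w r 0 j.succ = w j := rfl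

@[simp] theorem border_succ_zero (i : Fin p) : border W w r i.succ 0 = w i := rfl

@[simp] theorem border_succ_succ (i j : Fin p) : border W w r i.succ j.succ = W i j := rfl

theorem measurable_border : Measurable
    fun z : (Matrix (Fin p) (Fin p) ℝ × (Fin p → ℝ)) × ℝ ↦ border z.1.1 z.1.2 z.2 := by
  refine measurable_matrix fun i j ↦ ?_
  refine Fin.cases ?_ (fun i ↦ ?_) i <;> refine Fin.cases ?_ (fun j ↦ ?_) j <;>
    simp only [border_zero_zero, border_zero_succ, border_succ_zero, border_succ_succ]
  · fun_prop
  · fun_prop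
  · fun_prop
  · exact (measurable_entry i j).comp (measurable_fst.comp measurable_fst)

/-- The splitting of the indices `0, …, p` into the first one and the others. -/
def finSuccSumEquiv (p : ℕ) : Unit ⊕ Fin p ≃ Fin (p + 1) :=
  (Equiv.sumComm _ _).trans ((Equiv.optionEquivSumPUnit _).symm.trans (finSuccEquiv p).symm)

theorem border_submatrix : (border W w r).submatrix (finSuccSumEquiv p) (finSuccSumEquiv p) =
    Matrix.fromBlocks (Matrix.of fun _ _ ↦ r) (Matrix.of fun _ j ↦ w j)
      (Matrix.of fun (_ : Unit) j ↦ w j)ᴴ W := by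
  ext i j
  rcases i with i | i <;> rcases j with j | j <;> simp [finSuccSumEquiv]

variable {W}

theorem det_border (hW : W.PosDef) :
    (border W w r).det = W.det * (r - w ⬝ᵥ W⁻¹ *ᵥ w) := by
  have := hW.isUnit.invertible
  rw [← Matrix.det_submatrix_equiv_self (finSuccSumEquiv p), border_submatrix,
    Matrix.det_fromBlocks₂₂, Matrix.det_unique (n := Unit), Matrix.invOf_eq_nonsing_inv]
  congr 1
  rw [Matrix.sub_apply, Matrix.mul_assoc]
  simp [Matrix.mul_apply, Matrix.mulVec, dotProduct]

theorem posDef_of_border (h : (border W w r).PosDef) : W.PosDef :=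
  h.submatrix (Fin.succ_injective p)

/-- The Schur complement of `W` is a scalar, so its sign, which is that of the determinant, decides
definiteness. -/
theorem posDef_border_iff (hW : W.PosDef) :
    (border W w r).PosDef ↔ 0 < (border W w r).det := by
  refine ⟨fun h ↦ h.det_pos, fun h ↦ ?_⟩
  have := hW.isUnit.invertible
  have hq : 0 < r - w ⬝ᵥ W⁻¹ *ᵥ w := by
    rw [det_border w r hW] at h
    exact (pos_iff_pos_of_mul_pos h).1 hW.det_pos
  refine (Matrix.PosSemidef.posDef_iff_det_ne_zero ?_).2 h.ne'
  rw [← Matrix.posSemidef_submatrix_equiv (finSuccSumEquiv p), border_submatrix,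
    Matrix.PosDef.fromBlocks₂₂ _ _ hW]
  have hone : (Matrix.of fun (_ _ : Unit) ↦ r) - (Matrix.of fun (_ : Unit) j ↦ w j) * W⁻¹ *
      (Matrix.of fun (_ : Unit) j ↦ w j)ᴴ = Matrix.diagonal fun _ ↦ r - w ⬝ᵥ W⁻¹ *ᵥ w := by
    ext
    rw [Matrix.sub_apply, Matrix.mul_assoc]
    simp [Matrix.mul_apply, Matrix.mulVec, dotProduct]
  rw [hone]
  exact Matrix.PosSemidef.diagonal fun _ ↦ hq.le

end Border

/-! ### Upper triangular coordinates on symmetric matrices. -/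

section Upper

/-- The position of the entry `(i, j)` of a symmetric matrix on or above the diagonal. -/
def upperIndex {p : ℕ} (i j : Fin p) : {ij : Fin p × Fin p // ij.1 ≤ ij.2} :=
  ⟨(min i j, max i j), min_le_max⟩

/-- The entries on and above the diagonal. -/
def upper (p : ℕ) (M : Matrix (Fin p) (Fin p) ℝ) (ij : {ij : Fin p × Fin p // ij.1 ≤ ij.2}) : ℝ :=
  M ij.1.1 ij.1.2

variable {p : ℕ}

theorem symOfUpper_apply (x : {ij : Fin p × Fin p // ij.1 ≤ ij.2} → ℝ) (i j : Fin p) :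
    symOfUpper p x i j = x (upperIndex i j) := rfl

theorem upperIndex_comm (i j : Fin p) : upperIndex i j = upperIndex j i := by
  simp [upperIndex, min_comm, max_comm]

theorem upperIndex_coe (ij : {ij : Fin p × Fin p // ij.1 ≤ ij.2}) :
    upperIndex ij.1.1 ij.1.2 = ij := by
  have := ij.2
  simp [upperIndex, this]

theorem upper_symOfUpper (x : {ij : Fin p × Fin p // ij.1 ≤ ij.2} → ℝ) :
    upper p (symOfUpper p x) = x := by
  funext ij
  rw [upper, symOfUpper_apply, upperIndex_coe]

theorem symOfUpper_upper {M : Matrix (Fin p) (Fin p) ℝ} (hM : M.IsSymm) :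
    symOfUpper p (upper p M) = M := by
  ext i j
  rcases le_total i j with h | h <;> simp [symOfUpper_apply, upper, upperIndex, h, hM.apply]

theorem isSymm_symOfUpper (x : {ij : Fin p × Fin p // ij.1 ≤ ij.2} → ℝ) :
    (symOfUpper p x).IsSymm := by
  ext i j
  rw [Matrix.transpose_apply, symOfUpper_apply, symOfUpper_apply, upperIndex_comm]

theorem continuous_symOfUpper : Continuous (symOfUpper p) :=
  continuous_matrix fun i j ↦ continuous_apply (upperIndex i j)

theorem continuous_upper : Continuous (upper p) :=
  continuous_pi fun ij ↦ continuous_id.matrix_elem ij.1.1 ij.1.2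

theorem measurableEmbedding_symOfUpper : MeasurableEmbedding (symOfUpper p) :=
  (Topology.IsClosedEmbedding.measurableEmbedding
    (Function.LeftInverse.isClosedEmbedding upper_symOfUpper continuous_upper
      continuous_symOfUpper))

/-- The index of an upper triangular entry of a bordered matrix: an entry of the original matrix,
an entry of the new row, or the corner. -/
def borderIndex (p : ℕ) : {ij : Fin p × Fin p // ij.1 ≤ ij.2} ⊕ (Fin p ⊕ Unit) →
    {ij : Fin (p + 1) × Fin (p + 1) // ij.1 ≤ ij.2}
  | .inl ij => ⟨(ij.1.1.succ, ij.1.2.succ), Fin.succ_le_succ_iff.2 ij.2⟩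
  | .inr (.inl j) => ⟨(0, j.succ), Fin.zero_le _⟩
  | .inr (.inr _) => ⟨(0, 0), le_rfl⟩

theorem borderIndex_bijective (p : ℕ) : Function.Bijective (borderIndex p) := by
  constructor
  · rintro (⟨⟨i, j⟩, h⟩ | j | _) (⟨⟨i', j'⟩, h'⟩ | j' | _) <;>
      simp [borderIndex, Fin.succ_ne_zero, (Fin.succ_ne_zero _).symm]
  · rintro ⟨⟨i, j⟩, h⟩
    induction i using Fin.cases with
    | zero =>
      induction j using Fin.cases with
      | zero => exact ⟨.inr (.inr ()), rfl⟩
      | succ j => exact ⟨.inr (.inl j), rfl⟩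
    | succ i =>
      induction j using Fin.cases with
      | zero => simp at h
      | succ j => exact ⟨.inl ⟨(i, j), Fin.succ_le_succ_iff.1 h⟩, rfl⟩

theorem symOfUpper_border (z : {ij : Fin (p + 1) × Fin (p + 1) // ij.1 ≤ ij.2} → ℝ) :
    symOfUpper (p + 1) z = border (symOfUpper p fun ij ↦ z (borderIndex p (.inl ij)))
      (fun j ↦ z (borderIndex p (.inr (.inl j)))) (z (borderIndex p (.inr (.inr ())))) := by
  ext i j
  refine Fin.cases ?_ (fun i ↦ ?_) i <;> refine Fin.cases ?_ (fun j ↦ ?_) j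
  · rfl
  · rw [symOfUpper_apply, border_zero_succ]; rfl
  · rw [symOfUpper_apply, upperIndex_comm, border_succ_zero]; rfl
  · rw [symOfUpper_apply, border_succ_succ, symOfUpper_apply]
    congr 1
    rcases le_total i j with h | h <;> simp [upperIndex, borderIndex, h]

/-- Integration over the coordinates of a bordered symmetric matrix. -/
theorem lintegral_symOfUpper_succ (F : Matrix (Fin (p + 1)) (Fin (p + 1)) ℝ → ENNReal)
    (hF : Measurable F) :
    ∫⁻ z, F (symOfUpper (p + 1) z) = ∫⁻ v, ∫⁻ w, ∫⁻ r, F (border (symOfUpper p v) w r) := by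
  -- The coordinates are only permuted and regrouped as (old entries, new row, corner), and each
  -- regrouping preserves the product measure.
  let σ := Equiv.ofBijective _ (borderIndex_bijective p)
  have e₁ : MeasurePreserving (MeasurableEquiv.piCongrLeft (fun _ ↦ ℝ) σ) volume volume :=
    measurePreserving_piCongrLeft (fun _ ↦ (volume : Measure ℝ)) σ
  have e₂ : MeasurePreserving (MeasurableEquiv.sumPiEquivProdPi
      (fun _ : {ij : Fin p × Fin p // ij.1 ≤ ij.2} ⊕ (Fin p ⊕ Unit) ↦ ℝ)).symm volume volume :=
    (measurePreserving_sumPiEquivProdPi (fun _ ↦ (volume : Measure ℝ))).symm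
  have e₃ : MeasurePreserving (MeasurableEquiv.sumPiEquivProdPi
      (fun _ : Fin p ⊕ Unit ↦ ℝ)).symm volume volume :=
    (measurePreserving_sumPiEquivProdPi (fun _ ↦ (volume : Measure ℝ))).symm
  have e₄ := (MeasurePreserving.id (volume : Measure (Fin p → ℝ))).prod
    (volume_preserving_funUnique Unit ℝ).symm
  have e₅ := (MeasurePreserving.id (volume : Measure ({ij : Fin p × Fin p // ij.1 ≤ ij.2} → ℝ))).prod
    (e₃.comp e₄)
  have e := e₁.comp (e₂.comp e₅)
  have hsym (v : {ij : Fin p × Fin p // ij.1 ≤ ij.2} → ℝ) (w : Fin p → ℝ) (r : ℝ) :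
      symOfUpper (p + 1) (MeasurableEquiv.piCongrLeft (fun _ ↦ ℝ) σ
        ((MeasurableEquiv.sumPiEquivProdPi (fun _ ↦ ℝ)).symm
          (v, (MeasurableEquiv.sumPiEquivProdPi (fun _ ↦ ℝ)).symm
            (w, (MeasurableEquiv.funUnique Unit ℝ).symm r)))) = border (symOfUpper p v) w r := by
    set y := (MeasurableEquiv.sumPiEquivProdPi (fun _ ↦ ℝ)).symm
          (v, (MeasurableEquiv.sumPiEquivProdPi (fun _ ↦ ℝ)).symm
            (w, (MeasurableEquiv.funUnique Unit ℝ).symm r))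
    have h (a) : MeasurableEquiv.piCongrLeft (fun _ ↦ ℝ) σ y (borderIndex p a) = y a :=
      Equiv.piCongrLeft_apply_apply (fun _ ↦ ℝ) σ y a
    rw [symOfUpper_border]
    simp only [h]
    rfl
  have hm : Measurable fun z : ({ij : Fin p × Fin p // ij.1 ≤ ij.2} → ℝ) × ((Fin p → ℝ) × ℝ) ↦
      F (border (symOfUpper p z.1) z.2.1 z.2.2) := by
    refine hF.comp (measurable_border.comp (Measurable.prodMk (Measurable.prodMk ?_ ?_) ?_))
    · exact continuous_symOfUpper.measurable.comp measurable_fst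
    · fun_prop
    · fun_prop
  refine (e.lintegral_comp (hF.comp continuous_symOfUpper.measurable)).symm.trans ?_
  refine (lintegral_congr fun z : ({ij : Fin p × Fin p // ij.1 ≤ ij.2} → ℝ) × ((Fin p → ℝ) × ℝ) ↦
    congrArg F (hsym z.1 z.2.1 z.2.2)).trans ?_
  rw [lintegral_prod _ hm.aemeasurable]
  refine lintegral_congr fun v ↦ ?_
  rw [lintegral_prod]
  exact (hm.comp measurable_prodMk_left).aemeasurable

end Upper

/-! ### Push-forward of Lebesgue measure by the Gram matrix. -/

section Gram

open scoped Matrix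

open Classical in
/-- The function `W ↦ |W|^a` on positive definite matrices, extended by zero. -/
noncomputable def detPow {p : ℕ} (a : ℝ) (W : Matrix (Fin p) (Fin p) ℝ) : ENNReal :=
  if W.PosDef then ENNReal.ofReal (W.det ^ a) else 0

theorem measurable_detPow {p : ℕ} (a : ℝ) :
    Measurable (detPow a : Matrix (Fin p) (Fin p) ℝ → ENNReal) := by
  classical
  exact Measurable.ite (measurableSet_posDef p) ((measurable_det p).pow_const a).ennreal_ofReal
    measurable_const

theorem multivariateGamma_pos {p : ℕ} {a : ℝ} (h : (p : ℝ) ≤ 2 * a) :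
    0 < multivariateGamma p a := by
  refine mul_pos (Real.rpow_pos_of_pos Real.pi_pos _) (Finset.prod_pos fun i _ ↦
    Real.Gamma_pos_of_pos ?_)
  have : (i : ℝ) < p := by exact_mod_cast i.2
  linarith

theorem multivariateGamma_succ (p : ℕ) (a : ℝ) : multivariateGamma (p + 1) a =
    multivariateGamma p a * (Real.pi ^ ((p : ℝ) / 2) * Real.Gamma (a - (p : ℝ) / 2)) := by
  rw [multivariateGamma, multivariateGamma, Fin.prod_univ_castSucc]
  have : ((p + 1 : ℕ) : ℝ) * (((p + 1 : ℕ) : ℝ) - 1) / 4 = (p : ℝ) * (p - 1) / 4 + (p : ℝ) / 2 := by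
    push_cast; ring
  rw [this, Real.rpow_add Real.pi_pos]
  simp only [Fin.val_castSucc, Fin.val_last]
  ring

/-- The constant of the push-forward of Lebesgue measure by the Gram matrix. -/
noncomputable def gramConst (p m : ℕ) : ℝ :=
  Real.pi ^ ((m : ℝ) * p / 2) / multivariateGamma p ((m : ℝ) / 2)

theorem gramConst_pos {p m : ℕ} (h : p ≤ m) : 0 < gramConst p m :=
  div_pos (Real.rpow_pos_of_pos Real.pi_pos _) (multivariateGamma_pos (by
    have : (p : ℝ) ≤ m := by exact_mod_cast h
    linarith))

/-- The new factor is exactly the constant of `lintegral_fun_norm_sq` in dimension k: of the extra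
π^((p+k)/2), the part π^(p/2) cancels against `multivariateGamma_succ`. -/
theorem gramConst_succ (p k : ℕ) : gramConst (p + 1) (p + k) = gramConst p (p + k) *
    (Real.pi ^ ((k : ℝ) / 2) / Real.Gamma ((k : ℝ) / 2)) := by
  rw [gramConst, gramConst, multivariateGamma_succ]
  have h1 : ((p + k : ℕ) : ℝ) * ((p + 1 : ℕ) : ℝ) / 2 =
      ((p + k : ℕ) : ℝ) * p / 2 + ((p : ℝ) / 2 + (k : ℝ) / 2) := by push_cast; ring
  have h2 : ((p + k : ℕ) : ℝ) / 2 - (p : ℝ) / 2 = (k : ℝ) / 2 := by push_cast; ring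
  rw [h1, h2, Real.rpow_add Real.pi_pos, Real.rpow_add Real.pi_pos]
  have := Real.rpow_pos_of_pos Real.pi_pos ((p : ℝ) / 2)
  rw [div_mul_div_comm, mul_comm (Real.pi ^ ((p : ℝ) / 2)) (Real.pi ^ ((k : ℝ) / 2)), ← mul_assoc,
    mul_comm (Real.pi ^ ((p : ℝ) / 2)) (Real.Gamma _), ← mul_assoc,
    mul_div_mul_right _ _ this.ne']

variable {E : Type*} [NormedAddCommGroup E] [InnerProductSpace ℝ E]

theorem gram_succ {p : ℕ} (x : Fin (p + 1) → E) : Matrix.gram ℝ x =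
    border (Matrix.gram ℝ fun i : Fin p ↦ x i.succ) (fun i ↦ inner ℝ (x i.succ) (x 0))
      (‖x 0‖ ^ 2) := by
  ext i j
  refine Fin.cases ?_ (fun i ↦ ?_) i <;> refine Fin.cases ?_ (fun j ↦ ?_) j
  · simp
  · simp [real_inner_comm]
  · simp
  · simp

theorem continuous_gram (p : ℕ) : Continuous (Matrix.gram ℝ : (Fin p → E) → _) :=
  continuous_matrix fun i j ↦ by simp only [Matrix.gram_apply]; fun_prop

/-- The effect on a function of the Gram matrix of integrating out one more vector, in
codimension `k`. -/
noncomputable def borderIntegral {p : ℕ} (k : ℕ)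
    (F : Matrix (Fin (p + 1)) (Fin (p + 1)) ℝ → ENNReal)
    (W : Matrix (Fin p) (Fin p) ℝ) : ENNReal :=
  ENNReal.ofReal (√W.det)⁻¹ * ∫⁻ w, ∫⁻ r,
    {B | 0 < B.det}.indicator
      (fun B ↦ ENNReal.ofReal ((B.det / W.det) ^ ((k : ℝ) / 2 - 1)) * F B) (border W w r)

theorem measurable_borderIntegral {p : ℕ} (k : ℕ)
    {F : Matrix (Fin (p + 1)) (Fin (p + 1)) ℝ → ENNReal} (hF : Measurable F) :
    Measurable (borderIntegral k F) := by
  refine Measurable.mul ((measurable_det p).sqrt.inv.ennreal_ofReal) ?_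
  refine Measurable.lintegral_prod_right' (f := fun z : Matrix (Fin p) (Fin p) ℝ × (Fin p → ℝ) ↦
    ∫⁻ r, {B | 0 < B.det}.indicator
      (fun B ↦ ENNReal.ofReal ((B.det / z.1.det) ^ ((k : ℝ) / 2 - 1)) * F B)
        (border z.1 z.2 r)) ?_
  refine Measurable.lintegral_prod_right'
    (f := fun z : (Matrix (Fin p) (Fin p) ℝ × (Fin p → ℝ)) × ℝ ↦
    {B | 0 < B.det}.indicator
      (fun B ↦ ENNReal.ofReal ((B.det / z.1.1.det) ^ ((k : ℝ) / 2 - 1)) * F B)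
        (border z.1.1 z.1.2 z.2)) ?_
  have h1 := (measurable_det (p + 1)).comp (measurable_border (p := p))
  have h2 : Measurable fun z : (Matrix (Fin p) (Fin p) ℝ × (Fin p → ℝ)) × ℝ ↦ z.1.1.det :=
    (measurable_det p).comp (measurable_fst.comp measurable_fst)
  classical
  simp only [Set.indicator_apply]
  exact Measurable.ite (measurableSet_lt measurable_const h1)
    (((h1.div h2).pow_const _).ennreal_ofReal.mul (hF.comp measurable_border)) measurable_const

/-- The squared norm is r = q + s, with q = wᵀW⁻¹w the part inside the span. Translating by q
replaces s by r; since the bordered determinant is |W|s, the condition s > 0 becomes positivity of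
that determinant, and s becomes the ratio of determinants. -/
theorem lintegral_border_inner [FiniteDimensional ℝ E] [MeasurableSpace E] [BorelSpace E]
    {p k : ℕ} (hE : Module.finrank ℝ E = p + k) (hk : 0 < k)
    {F : Matrix (Fin (p + 1)) (Fin (p + 1)) ℝ → ENNReal} (hF : Measurable F)
    {x : Fin p → E} (hx : (Matrix.gram ℝ x).PosDef) :
    ∫⁻ y : E, F (border (Matrix.gram ℝ x) (fun i ↦ inner ℝ (x i) y) (‖y‖ ^ 2)) =
      ENNReal.ofReal (Real.pi ^ ((k : ℝ) / 2) / Real.Gamma ((k : ℝ) / 2)) *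
        borderIntegral k F (Matrix.gram ℝ x) := by
  have hx' := Matrix.linearIndependent_of_posDef_gram hx
  rw [lintegral_inner_norm_sq hE hk hx' (fun w r ↦ F (border (Matrix.gram ℝ x) w r)), borderIntegral]
  swap
  · exact hF.comp (measurable_border.comp
      ((measurable_const.prodMk measurable_fst).prodMk measurable_snd))
  congr 3
  funext w
  set q := w ⬝ᵥ (Matrix.gram ℝ x)⁻¹ *ᵥ w with hq
  rw [← lintegral_indicator measurableSet_Ioi]
  refine Eq.trans ?_ (lintegral_add_left_eq_self _ q)
  refine lintegral_congr fun s ↦ ?_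
  have hdet : (border (Matrix.gram ℝ x) w (q + s)).det = (Matrix.gram ℝ x).det * s := by
    rw [det_border _ _ hx, ← hq]; ring
  by_cases hs : 0 < s
  · rw [Set.indicator_of_mem (Set.mem_Ioi.2 hs), Set.indicator_of_mem (by
      simpa [hdet] using mul_pos hx.det_pos hs), hdet, mul_div_cancel_left₀ _ hx.det_pos.ne']
  · rw [Set.indicator_of_notMem (by simpa using hs), Set.indicator_of_notMem]
    simp only [Set.mem_ofPred_eq, hdet]
    exact fun h ↦ hs ((pos_iff_pos_of_mul_pos h).1 hx.det_pos)

/-- The total exponent of |W| is (k-1)/2 - 1/2 - (k/2-1) = 0, so only the bordered determinant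
survives. This is what makes the induction close. -/
theorem detPow_mul_borderIntegral {p k : ℕ}
    (F : Matrix (Fin (p + 1)) (Fin (p + 1)) ℝ → ENNReal) (W : Matrix (Fin p) (Fin p) ℝ) :
    detPow (((k : ℝ) - 1) / 2) W * borderIntegral k F W =
      ∫⁻ w, ∫⁻ r, detPow ((k : ℝ) / 2 - 1) (border W w r) * F (border W w r) := by
  by_cases hW : W.PosDef
  · rw [borderIntegral, ← mul_assoc, detPow, if_pos hW,
      ← ENNReal.ofReal_mul (Real.rpow_nonneg hW.det_pos.le _),
      ← lintegral_const_mul' _ _ ENNReal.ofReal_ne_top]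
    refine lintegral_congr fun w ↦ ?_
    rw [← lintegral_const_mul' _ _ ENNReal.ofReal_ne_top]
    refine lintegral_congr fun r ↦ ?_
    by_cases hB : 0 < (border W w r).det
    · rw [Set.indicator_of_mem (by exact hB), detPow, if_pos ((posDef_border_iff w r hW).2 hB),
        ← mul_assoc, ← ENNReal.ofReal_mul (mul_nonneg (Real.rpow_nonneg hW.det_pos.le _)
          (by positivity))]
      congr 2
      have hd := hW.det_pos
      rw [Real.sqrt_eq_rpow, ← Real.rpow_neg hd.le, ← Real.rpow_add hd,
        Real.div_rpow hB.le hd.le, mul_div_assoc', mul_comm, mul_div_assoc, ← Real.rpow_sub hd]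
      have : ((k : ℝ) - 1) / 2 + -(1 / 2) - (k / 2 - 1) = 0 := by ring
      rw [this, Real.rpow_zero, mul_one]
    · rw [Set.indicator_of_notMem (by exact hB), detPow,
        if_neg fun h ↦ hB ((posDef_border_iff w r hW).1 h), mul_zero, zero_mul]
  · have h (w r) : ¬ (border W w r).PosDef := fun h ↦ hW (posDef_of_border w r h)
    simp [detPow, hW, h]

/-- The push-forward of Lebesgue measure on `p`-tuples of vectors by the Gram matrix. -/
theorem lintegral_gram [FiniteDimensional ℝ E] [MeasurableSpace E] [BorelSpace E] (p : ℕ) {m : ℕ}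
    (hE : Module.finrank ℝ E = m) (hpm : p ≤ m)
    (F : Matrix (Fin p) (Fin p) ℝ → ENNReal) (hF : Measurable F) :
    ∫⁻ x : Fin p → E, F (Matrix.gram ℝ x) = ENNReal.ofReal (gramConst p m) *
      ∫⁻ v, detPow (((m : ℝ) - p - 1) / 2) (symOfUpper p v) * F (symOfUpper p v) := by
  induction p with
  | zero =>
    have hdet (W : Matrix (Fin 0) (Fin 0) ℝ) : detPow (((m : ℝ) - (0 : ℕ) - 1) / 2) W = 1 := by
      have : W.PosDef := by rw [Subsingleton.elim W 1]; exact Matrix.PosDef.one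
      simp [detPow, this]
    have hc : gramConst 0 m = 1 := by simp [gramConst, multivariateGamma]
    simp only [hdet, hc, Subsingleton.elim _ (1 : Matrix (Fin 0) (Fin 0) ℝ)]
    simp [volume_pi]
  | succ p ih =>
    obtain ⟨k, rfl⟩ : ∃ k, m = p + k := ⟨m - p, by omega⟩
    have hk : 0 < k := by omega
    have ih := ih (by omega)
    -- Almost every p-tuple is linearly independent: the induction hypothesis is applied to the
    -- indicator of the matrices that are not positive definite, on which `detPow` vanishes.
    have hae : ∀ᵐ x : Fin p → E, (Matrix.gram ℝ x).PosDef := by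
      have h0 := ih ({W | W.PosDef}ᶜ.indicator 1)
        (measurable_one.indicator (measurableSet_posDef p).compl)
      have h1 (v) : detPow (((p + k : ℕ) - p - 1 : ℝ) / 2) (symOfUpper p v) *
          {W | W.PosDef}ᶜ.indicator 1 (symOfUpper p v) = 0 := by
        by_cases h : (symOfUpper p v).PosDef <;> simp [detPow, h]
      simp only [h1, lintegral_zero, mul_zero] at h0
      filter_upwards [(lintegral_eq_zero_iff ((measurable_one.indicator
        (measurableSet_posDef p).compl).comp (continuous_gram p).measurable)).1 h0] with x hx
      by_contra h
      simp [h] at hx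
    have hm : Measurable fun z : E × (Fin p → E) ↦ F (border (Matrix.gram ℝ z.2)
        (fun i ↦ inner ℝ (z.2 i) z.1) (‖z.1‖ ^ 2)) := by
      refine hF.comp (measurable_border.comp (Measurable.prodMk (Measurable.prodMk ?_ ?_) ?_))
      · exact (continuous_gram p).measurable.comp measurable_snd
      · exact Continuous.measurable (by fun_prop)
      · fun_prop
    calc ∫⁻ x : Fin (p + 1) → E, F (Matrix.gram ℝ x)
        = ∫⁻ z : E × (Fin p → E), F (border (Matrix.gram ℝ z.2)
          (fun i ↦ inner ℝ (z.2 i) z.1) (‖z.1‖ ^ 2)) := by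
          rw [← (volume_preserving_piFinSuccAbove (fun _ : Fin (p + 1) ↦ E) 0).lintegral_comp hm]
          refine lintegral_congr fun x ↦ ?_
          rw [gram_succ]
          rfl
      _ = ∫⁻ x : Fin p → E, ∫⁻ y : E, F (border (Matrix.gram ℝ x)
          (fun i ↦ inner ℝ (x i) y) (‖y‖ ^ 2)) := by
          rw [Measure.volume_eq_prod, lintegral_prod_symm' _ hm]
      _ = ∫⁻ x : Fin p → E, ENNReal.ofReal (Real.pi ^ ((k : ℝ) / 2) / Real.Gamma ((k : ℝ) / 2)) *
            borderIntegral k F (Matrix.gram ℝ x) := by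
          refine lintegral_congr_ae ?_
          filter_upwards [hae] with x hx
          exact lintegral_border_inner hE hk hF hx
      _ = _ := by
          rw [lintegral_const_mul' _ _ ENNReal.ofReal_ne_top,
            ih _ (measurable_borderIntegral k hF), gramConst_succ, mul_comm (gramConst _ _),
            ENNReal.ofReal_mul, mul_assoc]
          swap
          · have : (0 : ℝ) < k := by exact_mod_cast hk
            positivity
          congr 2
          -- With m = p + k, the exponents for p and p + 1 vectors are (k-1)/2 and k/2 - 1.
          have e1 : (((p + k : ℕ) : ℝ) - p - 1) / 2 = ((k : ℝ) - 1) / 2 := by push_cast; ring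
          have e2 : (((p + k : ℕ) : ℝ) - ((p + 1 : ℕ) : ℝ) - 1) / 2 = (k : ℝ) / 2 - 1 := by
            push_cast; ring
          rw [e1, e2]
          exact (lintegral_congr fun v ↦ detPow_mul_borderIntegral F _).trans
            (lintegral_symOfUpper_succ _ ((measurable_detPow _).mul hF)).symm

end Gram

/-! ### Product measures: densities, currying and transposition. -/

section PiMeasure

theorem lintegral_prod_eval {n : ℕ} {α : Type*} [MeasurableSpace α] (μ : Fin n → Measure α)
    [∀ i, SigmaFinite (μ i)] {f : α → ENNReal} (hf : Measurable f) :
    ∫⁻ x, ∏ i, f (x i) ∂Measure.pi μ = ∏ i, ∫⁻ a, f a ∂μ i := by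
  induction n with
  | zero => simp
  | succ n ih =>
    have hm : Measurable fun x : Fin n → α ↦ ∏ i, f (x i) :=
      Finset.measurable_fun_prod _ fun i _ ↦ hf.comp (measurable_pi_apply i)
    rw [Fin.prod_univ_succ, ← ih fun i ↦ μ i.succ, ← lintegral_prod_mul hf.aemeasurable
      hm.aemeasurable]
    refine Eq.trans ?_ ((measurePreserving_piFinSuccAbove μ 0).lintegral_comp
      ((hf.comp measurable_fst).mul (hm.comp measurable_snd)))
    refine lintegral_congr fun x ↦ ?_
    rw [Fin.prod_univ_succ]
    rfl

theorem pi_withDensity {n : ℕ} {α : Type*} [MeasurableSpace α] (μ : Measure α)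
    [SigmaFinite μ] {f : α → ENNReal} (hf : Measurable f) [SigmaFinite (μ.withDensity f)] :
    Measure.pi (fun _ : Fin n ↦ μ.withDensity f) =
      (Measure.pi fun _ ↦ μ).withDensity fun x ↦ ∏ i, f (x i) := by
  refine (Measure.pi_eq fun s hs ↦ ?_)
  rw [withDensity_apply _ (MeasurableSet.univ_pi hs), Measure.restrict_pi_pi,
    lintegral_prod_eval _ hf]
  exact Finset.prod_congr rfl fun i _ ↦ (withDensity_apply _ (hs i)).symm

theorem measurePreserving_uncurry (ι κ : Type*) [Fintype ι] [Fintype κ] :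
    MeasurePreserving (MeasurableEquiv.curry ι κ ℝ).symm volume volume := by
  refine ⟨MeasurableEquiv.measurable _, (Measure.pi_eq fun s hs ↦ ?_).symm⟩
  have : (MeasurableEquiv.curry ι κ ℝ).symm ⁻¹' (Set.univ.pi s) =
      Set.univ.pi fun i ↦ Set.univ.pi fun j ↦ s (i, j) := by
    ext x
    simp [MeasurableEquiv.curry, Function.uncurry, Set.mem_pi]
  rw [MeasurableEquiv.map_apply, this, volume_pi_pi, Fintype.prod_prod_type]
  simp only [volume_pi_pi]

theorem measurePreserving_transpose (ι κ : Type*) [Fintype ι] [Fintype κ] :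
    MeasurePreserving (fun (x : ι → κ → ℝ) j i ↦ x i j) volume volume :=
  (measurePreserving_uncurry κ ι).symm.comp
    ((volume_preserving_arrowCongr' (Equiv.prodComm ι κ) (MeasurableEquiv.refl ℝ)
      (MeasurePreserving.id _)).comp (measurePreserving_uncurry ι κ))

end PiMeasure

/-! ### The Gaussian density and the law of the Wishart matrix. -/

section Gaussian

open scoped Matrix

/-- The density of the centred Gaussian vector with covariance matrix `S`. -/
noncomputable def gaussianDensity {p : ℕ} (S : Matrix (Fin p) (Fin p) ℝ) (w : Fin p → ℝ) : ℝ :=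
  (√(2 * Real.pi))⁻¹ ^ p * (√S.det)⁻¹ * Real.exp (-(1 / 2) * (w ⬝ᵥ S⁻¹ *ᵥ w))

theorem continuous_gaussianDensity {p : ℕ} (S : Matrix (Fin p) (Fin p) ℝ) :
    Continuous (gaussianDensity S) := by
  unfold gaussianDensity
  have : Continuous fun w : Fin p → ℝ ↦ w ⬝ᵥ S⁻¹ *ᵥ w :=
    continuous_id.dotProduct (continuous_const.matrix_mulVec continuous_id)
  fun_prop

theorem prod_gaussianPDF {p : ℕ} (z : Fin p → ℝ) : ∏ i, gaussianPDF 0 1 (z i) =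
    ENNReal.ofReal ((√(2 * Real.pi))⁻¹ ^ p * Real.exp (-(1 / 2) * (z ⬝ᵥ z))) := by
  simp only [gaussianPDF]
  rw [← ENNReal.ofReal_prod_of_nonneg fun i _ ↦ gaussianPDFReal_nonneg _ _ _]
  simp only [gaussianPDFReal, NNReal.coe_one, mul_one, sub_zero, Finset.prod_mul_distrib,
    Finset.prod_const, Finset.card_univ, Fintype.card_fin, ← Real.exp_sum]
  congr 3
  rw [dotProduct, Finset.mul_sum]
  exact Finset.sum_congr rfl fun i _ ↦ by ring

theorem lintegral_stdGaussian {p : ℕ} {G : EuclideanSpace ℝ (Fin p) → ENNReal}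
    (hG : Measurable G) : ∫⁻ u, G u ∂stdGaussian (EuclideanSpace ℝ (Fin p)) =
      ∫⁻ u : EuclideanSpace ℝ (Fin p), ENNReal.ofReal ((√(2 * Real.pi))⁻¹ ^ p *
        Real.exp (-(1 / 2) * (u.ofLp ⬝ᵥ u.ofLp))) * G u := by
  have hsf : SigmaFinite ((volume : Measure ℝ).withDensity (gaussianPDF 0 1)) := by
    rw [← gaussianReal_of_var_ne_zero 0 one_ne_zero]; infer_instance
  have hprod : Measurable fun z : Fin p → ℝ ↦ ∏ i, gaussianPDF 0 1 (z i) :=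
    Finset.measurable_fun_prod _ fun i _ ↦
      (measurable_gaussianPDF 0 1).comp (measurable_pi_apply i)
  have hG' : Measurable fun z : Fin p → ℝ ↦ G (WithLp.toLp 2 z) := hG.comp (by fun_prop)
  rw [← map_pi_eq_stdGaussian, lintegral_map hG (by fun_prop),
    gaussianReal_of_var_ne_zero 0 one_ne_zero, pi_withDensity volume (measurable_gaussianPDF 0 1),
    lintegral_withDensity_eq_lintegral_mul _ hprod hG']
  refine ((PiLp.volume_preserving_ofLp (Fin p)).lintegral_comp (hprod.mul hG')).symm.trans ?_
  refine lintegral_congr fun u ↦ ?_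
  rw [Pi.mul_apply, prod_gaussianPDF]

/-- The Gaussian is the image of the standard one under A = √S, so the density comes from the linear
change of variables w = A u, with det A = √(det S). -/
theorem multivariateGaussian_eq_withDensity {p : ℕ} {S : Matrix (Fin p) (Fin p) ℝ}
    (hS : S.PosDef) : multivariateGaussian 0 S =
      (volume : Measure (EuclideanSpace ℝ (Fin p))).withDensity
        fun y ↦ ENNReal.ofReal (gaussianDensity S y.ofLp) := by
  set A := CFC.sqrt S with hA
  obtain ⟨hApos, hAS⟩ := (eq_sqrt_iff hS).1 hA
  have hAt : Aᵀ = A := by simpa using hApos.isHermitian.eq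
  have hAA : S = A * Aᵀ := by rw [hAt, ← sq, hAS]
  have hdet : √S.det = A.det := by
    rw [← hAS, Matrix.det_pow, Real.sqrt_sq hApos.det_pos.le]
  have hd : Measurable fun w : Fin p → ℝ ↦ ENNReal.ofReal (gaussianDensity S w) :=
    (continuous_gaussianDensity S).measurable.ennreal_ofReal
  have hinv : 0 < A.det⁻¹ := inv_pos.2 hApos.det_pos
  have hdA (u : Fin p → ℝ) : gaussianDensity S (A *ᵥ u) =
      A.det⁻¹ * ((√(2 * Real.pi))⁻¹ ^ p * Real.exp (-(1 / 2) * (u ⬝ᵥ u))) := by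
    rw [gaussianDensity, hdet, hAA, mulVec_dotProduct_inv_mulVec hApos.det_pos.ne']
    ring
  refine Measure.ext_of_lintegral _ fun G hG ↦ ?_
  have hL : Measurable fun x : EuclideanSpace ℝ (Fin p) ↦
      (0 : EuclideanSpace ℝ (Fin p)) + Matrix.toEuclideanCLM (𝕜 := ℝ) A x := by fun_prop
  have hG' : Measurable fun z : Fin p → ℝ ↦ G (WithLp.toLp 2 z) := hG.comp (by fun_prop)
  have key := lintegral_comp_mulVec A hApos.det_pos.ne'
    (fun w ↦ ENNReal.ofReal (gaussianDensity S w) * G (WithLp.toLp 2 w)) (hd.mul hG')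
  simp only [hdA, ENNReal.ofReal_mul hinv.le, mul_assoc, abs_of_pos hinv] at key
  rw [lintegral_const_mul' _ _ ENNReal.ofReal_ne_top] at key
  have key := (ENNReal.mul_right_inj (ENNReal.ofReal_pos.2 hinv).ne' ENNReal.ofReal_ne_top).1 key
  have hdE : Measurable fun y : EuclideanSpace ℝ (Fin p) ↦
      ENNReal.ofReal (gaussianDensity S y.ofLp) := hd.comp (by fun_prop)
  have hGL : Measurable fun x : EuclideanSpace ℝ (Fin p) ↦
      G (0 + Matrix.toEuclideanCLM (𝕜 := ℝ) A x) := hG.comp hL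
  rw [multivariateGaussian, lintegral_map hG hL, lintegral_stdGaussian hGL,
    lintegral_withDensity_eq_lintegral_mul _ hdE hG]
  have h3 := (PiLp.volume_preserving_ofLp (Fin p)).lintegral_comp (hd.mul hG')
  refine Eq.trans ?_ h3.symm
  refine Eq.trans (lintegral_congr fun u ↦ ?_) key
  rw [zero_add]
  rfl

/-- Since xᵀS⁻¹x = tr(S⁻¹xxᵀ), the exponents add up to a function of ∑ xᵢxᵢᵀ alone. -/
theorem prod_gaussianDensity {p m : ℕ} (S : Matrix (Fin p) (Fin p) ℝ)
    (x : Fin m → EuclideanSpace ℝ (Fin p)) :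
    ∏ i, ENNReal.ofReal (gaussianDensity S (x i).ofLp) =
      ENNReal.ofReal (((√(2 * Real.pi))⁻¹ ^ p * (√S.det)⁻¹) ^ m * Real.exp (-(1 / 2) *
        (S⁻¹ * ∑ i, Matrix.vecMulVec (x i).ofLp (x i).ofLp).trace)) := by
  have h0 (w : Fin p → ℝ) : 0 ≤ gaussianDensity S w := by unfold gaussianDensity; positivity
  rw [← ENNReal.ofReal_prod_of_nonneg fun i _ ↦ h0 _]
  simp only [gaussianDensity, Finset.prod_mul_distrib, Finset.prod_const, Finset.card_univ,
    Fintype.card_fin, ← Real.exp_sum, mul_pow]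
  congr 3
  rw [Finset.mul_sum, Matrix.trace_sum, Finset.mul_sum]
  refine Finset.sum_congr rfl fun i _ ↦ ?_
  rw [Matrix.mul_vecMulVec, Matrix.trace_vecMulVec, dotProduct_comm]

/-- The Wishart density, up to the factor `|W|^((m-p-1)/2)`. -/
noncomputable def wishartDensity {p : ℕ} (m : ℕ) (S W : Matrix (Fin p) (Fin p) ℝ) : ℝ :=
  ((√(2 * Real.pi))⁻¹ ^ p * (√S.det)⁻¹) ^ m * Real.exp (-(1 / 2) * (S⁻¹ * W).trace)

theorem measurable_wishartDensity {p : ℕ} (m : ℕ) (S : Matrix (Fin p) (Fin p) ℝ) :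
    Measurable (wishartDensity m S) := by
  unfold wishartDensity
  have : Continuous fun W : Matrix (Fin p) (Fin p) ℝ ↦ (S⁻¹ * W).trace :=
    (continuous_const.matrix_mul continuous_id).matrix_trace
  exact (by fun_prop : Continuous fun W : Matrix (Fin p) (Fin p) ℝ ↦
    ((√(2 * Real.pi))⁻¹ ^ p * (√S.det)⁻¹) ^ m * Real.exp (-(1 / 2) * (S⁻¹ * W).trace)).measurable

theorem lintegral_wishart {p m : ℕ} (hpm : p ≤ m) {S : Matrix (Fin p) (Fin p) ℝ} (hS : S.PosDef)
    {F : Matrix (Fin p) (Fin p) ℝ → ENNReal} (hF : Measurable F) :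
    ∫⁻ W, F W ∂wishart p m S = ENNReal.ofReal (gramConst p m) *
      ∫⁻ v, detPow (((m : ℝ) - p - 1) / 2) (symOfUpper p v) *
        (ENNReal.ofReal (wishartDensity m S (symOfUpper p v)) * F (symOfUpper p v)) := by
  have hT : Measurable fun x : Fin m → EuclideanSpace ℝ (Fin p) ↦
      ∑ i, Matrix.vecMulVec (x i).ofLp (x i).ofLp := by
    refine measurable_matrix fun i j ↦ ?_
    simp only [Matrix.sum_apply, Matrix.vecMulVec_apply]
    fun_prop
  have hd : Measurable fun y : EuclideanSpace ℝ (Fin p) ↦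
      ENNReal.ofReal (gaussianDensity S y.ofLp) :=
    ((continuous_gaussianDensity S).comp (by fun_prop)).measurable.ennreal_ofReal
  have hprod : Measurable fun x : Fin m → EuclideanSpace ℝ (Fin p) ↦
      ∏ i, ENNReal.ofReal (gaussianDensity S (x i).ofLp) :=
    Finset.measurable_fun_prod _ fun i _ ↦ hd.comp (measurable_pi_apply i)
  have hFT : Measurable fun x : Fin m → EuclideanSpace ℝ (Fin p) ↦
      F (∑ i, Matrix.vecMulVec (x i).ofLp (x i).ofLp) := hF.comp hT
  have hsf : SigmaFinite ((volume : Measure (EuclideanSpace ℝ (Fin p))).withDensity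
      fun y ↦ ENNReal.ofReal (gaussianDensity S y.ofLp)) := by
    rw [← multivariateGaussian_eq_withDensity hS]; infer_instance
  have hF' : Measurable fun W ↦ ENNReal.ofReal (wishartDensity m S W) * F W :=
    (measurable_wishartDensity m S).ennreal_ofReal.mul hF
  rw [← lintegral_gram (E := EuclideanSpace ℝ (Fin m)) p (by simp) hpm _ hF', wishart,
    lintegral_map hF hT, multivariateGaussian_eq_withDensity hS, pi_withDensity volume hd,
    lintegral_withDensity_eq_lintegral_mul _ hprod hFT]
  -- Transposition: m vectors of ℝ^p are read as p vectors of ℝ^m, whose Gram matrix is the sum of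
  -- outer products.
  have e := (volume_preserving_pi fun _ : Fin p ↦ PiLp.volume_preserving_toLp (Fin m)).comp
    ((measurePreserving_transpose (Fin m) (Fin p)).comp
      (volume_preserving_pi fun _ : Fin m ↦ PiLp.volume_preserving_ofLp (Fin p)))
  refine Eq.trans ?_ (e.lintegral_comp (hF'.comp (continuous_gram p).measurable))
  refine lintegral_congr fun x ↦ ?_
  have hg : Matrix.gram ℝ (fun j : Fin p ↦ WithLp.toLp 2 fun i ↦ (x i).ofLp j) =
      ∑ i, Matrix.vecMulVec (x i).ofLp (x i).ofLp := by
    ext i j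
    simp [Matrix.sum_apply, Matrix.vecMulVec_apply, PiLp.inner_apply, mul_comm]
  rw [Pi.mul_apply, prod_gaussianDensity, ← hg]
  rfl

end Gaussian

/-! ### The Jacobian of squaring symmetric matrices. -/

section Lyapunov

open scoped Matrix

variable {p : ℕ}

theorem symOfUpper_add (x y : {ij : Fin p × Fin p // ij.1 ≤ ij.2} → ℝ) :
    symOfUpper p (x + y) = symOfUpper p x + symOfUpper p y := rfl

theorem symOfUpper_smul (c : ℝ) (x : {ij : Fin p × Fin p // ij.1 ≤ ij.2} → ℝ) :
    symOfUpper p (c • x) = c • symOfUpper p x := rfl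

theorem upper_add (M N : Matrix (Fin p) (Fin p) ℝ) : upper p (M + N) = upper p M + upper p N := rfl

theorem upper_smul (c : ℝ) (M : Matrix (Fin p) (Fin p) ℝ) : upper p (c • M) = c • upper p M := rfl

/-- The operator `H ↦ V H + H V` on symmetric matrices, in coordinates. -/
noncomputable def lyapunov (V : Matrix (Fin p) (Fin p) ℝ) :
    ({ij : Fin p × Fin p // ij.1 ≤ ij.2} → ℝ) →L[ℝ] ({ij : Fin p × Fin p // ij.1 ≤ ij.2} → ℝ) :=
  LinearMap.toContinuousLinearMap
    { toFun := fun x ↦ upper p (V * symOfUpper p x + symOfUpper p x * V)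
      map_add' := fun x y ↦ by
        rw [symOfUpper_add, ← upper_add]; congr 1; noncomm_ring
      map_smul' := fun c x ↦ by
        rw [symOfUpper_smul, RingHom.id_apply, ← upper_smul]
        simp }

theorem lyapunov_apply (V : Matrix (Fin p) (Fin p) ℝ)
    (x : {ij : Fin p × Fin p // ij.1 ≤ ij.2} → ℝ) :
    lyapunov V x = upper p (V * symOfUpper p x + symOfUpper p x * V) := rfl

theorem isSymm_conj {M : Matrix (Fin p) (Fin p) ℝ} (hM : M.IsSymm)
    (U : Matrix (Fin p) (Fin p) ℝ) : (U * M * Uᵀ).IsSymm := by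
  rw [Matrix.IsSymm, Matrix.transpose_mul, Matrix.transpose_mul, Matrix.transpose_transpose, hM.eq,
    Matrix.mul_assoc]

theorem isSymm_mul_add_mul {V M : Matrix (Fin p) (Fin p) ℝ} (hV : V.IsSymm) (hM : M.IsSymm) :
    (V * M + M * V).IsSymm := by
  rw [Matrix.IsSymm, Matrix.transpose_add, Matrix.transpose_mul, Matrix.transpose_mul, hV.eq, hM.eq,
    add_comm]

/-- Conjugation by an orthogonal matrix on symmetric matrices, in coordinates. -/
noncomputable def conjEquiv (U : Matrix (Fin p) (Fin p) ℝ) (h : Uᵀ * U = 1) :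
    ({ij : Fin p × Fin p // ij.1 ≤ ij.2} → ℝ) ≃ₗ[ℝ] ({ij : Fin p × Fin p // ij.1 ≤ ij.2} → ℝ) where
  toFun x := upper p (U * symOfUpper p x * Uᵀ)
  invFun x := upper p (Uᵀ * symOfUpper p x * U)
  map_add' x y := by
    rw [symOfUpper_add, ← upper_add]; congr 1; noncomm_ring
  map_smul' c x := by
    rw [symOfUpper_smul, RingHom.id_apply, ← upper_smul]
    simp
  left_inv x := by
    simp only
    rw [symOfUpper_upper (isSymm_conj (isSymm_symOfUpper x) U)]
    have : Uᵀ * (U * symOfUpper p x * Uᵀ) * U = (Uᵀ * U) * symOfUpper p x * (Uᵀ * U) := by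
      noncomm_ring
    rw [this, h, Matrix.one_mul, Matrix.mul_one, upper_symOfUpper]
  right_inv x := by
    have h' : U * Uᵀ = 1 := mul_eq_one_comm.1 h
    have hs := isSymm_conj (isSymm_symOfUpper x) Uᵀ
    rw [Matrix.transpose_transpose] at hs
    simp only
    rw [symOfUpper_upper hs]
    have : U * (Uᵀ * symOfUpper p x * U) * Uᵀ = (U * Uᵀ) * symOfUpper p x * (U * Uᵀ) := by
      noncomm_ring
    rw [this, h', Matrix.one_mul, Matrix.mul_one, upper_symOfUpper]

theorem conjEquiv_apply (U : Matrix (Fin p) (Fin p) ℝ) (h : Uᵀ * U = 1)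
    (x : {ij : Fin p × Fin p // ij.1 ≤ ij.2} → ℝ) :
    conjEquiv U h x = upper p (U * symOfUpper p x * Uᵀ) := rfl

theorem conjEquiv_symm_apply (U : Matrix (Fin p) (Fin p) ℝ) (h : Uᵀ * U = 1)
    (x : {ij : Fin p × Fin p // ij.1 ≤ ij.2} → ℝ) :
    (conjEquiv U h).symm x = upper p (Uᵀ * symOfUpper p x * U) := rfl

/-- Orthogonal conjugation respects products, so the operator of UVUᵀ is similar to that of V. This
reduces its determinant to diagonal V. -/
theorem lyapunov_conj {V U : Matrix (Fin p) (Fin p) ℝ} (hV : V.IsSymm) (h : Uᵀ * U = 1) :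
    (lyapunov (U * V * Uᵀ)).toLinearMap =
      (conjEquiv U h).toLinearMap ∘ₗ (lyapunov V).toLinearMap ∘ₗ (conjEquiv U h).symm.toLinearMap := by
  have h' : U * Uᵀ = 1 := mul_eq_one_comm.1 h
  refine LinearMap.ext fun x ↦ ?_
  have hs := isSymm_conj (isSymm_symOfUpper x) Uᵀ
  rw [Matrix.transpose_transpose] at hs
  simp only [LinearMap.comp_apply, LinearEquiv.coe_coe, ContinuousLinearMap.coe_coe,
    conjEquiv_apply, conjEquiv_symm_apply, lyapunov_apply]
  rw [symOfUpper_upper hs, symOfUpper_upper (isSymm_mul_add_mul hV hs)]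
  congr 1
  have e : U * (V * (Uᵀ * symOfUpper p x * U) + Uᵀ * symOfUpper p x * U * V) * Uᵀ =
      U * V * Uᵀ * symOfUpper p x * (U * Uᵀ) + (U * Uᵀ) * symOfUpper p x * (U * V * Uᵀ) := by
    noncomm_ring
  rw [e, h', Matrix.mul_one, Matrix.one_mul]

theorem det_lyapunov_diagonal (d : Fin p → ℝ) : (lyapunov (Matrix.diagonal d)).det =
    ∏ ij : {ij : Fin p × Fin p // ij.1 ≤ ij.2}, (d ij.1.1 + d ij.1.2) := by
  have : (lyapunov (Matrix.diagonal d)).toLinearMap = Matrix.toLin' (Matrix.diagonal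
      fun ij : {ij : Fin p × Fin p // ij.1 ≤ ij.2} ↦ d ij.1.1 + d ij.1.2) := by
    refine LinearMap.ext fun x ↦ ?_
    change lyapunov (Matrix.diagonal d) x = _
    funext ij
    rw [lyapunov_apply, Matrix.toLin'_apply, Matrix.mulVec_diagonal, upper, Matrix.add_apply,
      Matrix.diagonal_mul, Matrix.mul_diagonal, symOfUpper_apply, upperIndex_coe]
    ring
  rw [ContinuousLinearMap.det, this, LinearMap.det_toLin', Matrix.det_diagonal]

/-- The diagonal pairs i = j contribute the factors 2dᵢ. -/
theorem prod_upper (d : Fin p → ℝ) :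
    ∏ ij : {ij : Fin p × Fin p // ij.1 ≤ ij.2}, (d ij.1.1 + d ij.1.2) =
      2 ^ p * (∏ i, d i) * ∏ ij : Fin p × Fin p with ij.1 < ij.2, (d ij.1 + d ij.2) := by
  have h1 : ∏ ij : {ij : Fin p × Fin p // ij.1 ≤ ij.2}, (d ij.1.1 + d ij.1.2) =
      ∏ ij : Fin p × Fin p with ij.1 ≤ ij.2, (d ij.1 + d ij.2) :=
    (Finset.prod_subtype _ (by simp) fun ij : Fin p × Fin p ↦ d ij.1 + d ij.2).symm
  have h2 : (Finset.univ.filter fun ij : Fin p × Fin p ↦ ij.1 ≤ ij.2) =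
      (Finset.univ.filter fun ij : Fin p × Fin p ↦ ij.1 = ij.2) ∪
        Finset.univ.filter fun ij : Fin p × Fin p ↦ ij.1 < ij.2 := by
    ext ij; simp [le_iff_eq_or_lt]
  have h3 : Disjoint (Finset.univ.filter fun ij : Fin p × Fin p ↦ ij.1 = ij.2)
      (Finset.univ.filter fun ij : Fin p × Fin p ↦ ij.1 < ij.2) :=
    Finset.disjoint_filter.2 fun ij _ h h' ↦ h'.ne h
  have h4 : ∏ ij : Fin p × Fin p with ij.1 = ij.2, (d ij.1 + d ij.2) = ∏ i, (2 * d i) := by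
    symm
    refine Finset.prod_bij (fun i _ ↦ (i, i)) (by simp) (by simp) ?_ (fun i _ ↦ by simp [two_mul])
    rintro ⟨i, j⟩ h
    exact ⟨i, by simp, by simpa using h⟩
  rw [h1, h2, Finset.prod_union h3, h4, Finset.prod_mul_distrib]
  simp

theorem det_lyapunov {V : Matrix (Fin p) (Fin p) ℝ} (hV : V.IsHermitian) :
    (lyapunov V).det = 2 ^ p * V.det *
      ∏ ij : Fin p × Fin p with ij.1 < ij.2, (hV.eigenvalues ij.1 + hV.eigenvalues ij.2) := by
  set U : Matrix (Fin p) (Fin p) ℝ := hV.eigenvectorUnitary.1 with hU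
  have h : Uᵀ * U = 1 := by
    simpa [Matrix.star_eq_conjTranspose] using Unitary.coe_star_mul_self hV.eigenvectorUnitary
  have hspec : V = U * Matrix.diagonal hV.eigenvalues * Uᵀ := by
    simpa [Unitary.conjStarAlgAut_apply, Matrix.star_eq_conjTranspose, Function.comp_def]
      using hV.spectral_theorem
  have hdet : V.det = ∏ i, hV.eigenvalues i := by simpa using hV.det_eq_prod_eigenvalues
  have hdiag : (Matrix.diagonal hV.eigenvalues).IsSymm := Matrix.diagonal_transpose _
  rw [hdet, ← prod_upper, ← det_lyapunov_diagonal]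
  conv_lhs => rw [hspec]
  rw [ContinuousLinearMap.det, lyapunov_conj hdiag h, LinearMap.det_conj]

/-- Squaring of symmetric matrices, in coordinates. -/
noncomputable def sqUpper (x : {ij : Fin p × Fin p // ij.1 ≤ ij.2} → ℝ) :
    {ij : Fin p × Fin p // ij.1 ≤ ij.2} → ℝ :=
  upper p (symOfUpper p x ^ 2)

theorem symOfUpper_sqUpper (x : {ij : Fin p × Fin p // ij.1 ≤ ij.2} → ℝ) :
    symOfUpper p (sqUpper x) = symOfUpper p x ^ 2 := by
  refine symOfUpper_upper ?_
  rw [Matrix.IsSymm, Matrix.transpose_pow, (isSymm_symOfUpper x).eq]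

theorem hasFDerivAt_sqUpper (x : {ij : Fin p × Fin p // ij.1 ≤ ij.2} → ℝ) :
    HasFDerivAt sqUpper (lyapunov (symOfUpper p x)) x := by
  refine hasFDerivAt_pi'.2 fun ij ↦ ?_
  have hf : (fun x : {ij : Fin p × Fin p // ij.1 ≤ ij.2} → ℝ ↦ sqUpper x ij) =
      fun x ↦ ∑ k, x (upperIndex ij.1.1 k) * x (upperIndex k ij.1.2) := by
    funext x
    rw [sqUpper, upper, sq, Matrix.mul_apply]
    rfl
  rw [hf]
  have hd := HasFDerivAt.fun_sum (u := Finset.univ) fun (k : Fin p) _ ↦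
    (hasFDerivAt_apply (𝕜 := ℝ) (upperIndex ij.1.1 k) x).mul
      (hasFDerivAt_apply (𝕜 := ℝ) (upperIndex k ij.1.2) x)
  refine hd.congr_fderiv ?_
  ext1 h
  have : (lyapunov (symOfUpper p x) h) ij = ∑ k,
      (x (upperIndex ij.1.1 k) * h (upperIndex k ij.1.2) +
        h (upperIndex ij.1.1 k) * x (upperIndex k ij.1.2)) := by
    rw [lyapunov_apply, upper, Matrix.add_apply, Matrix.mul_apply, Matrix.mul_apply,
      Finset.sum_add_distrib]
    rfl
  rw [ContinuousLinearMap.comp_apply, ContinuousLinearMap.proj_apply, this]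
  simp [mul_comm]

theorem posDef_sq {V : Matrix (Fin p) (Fin p) ℝ} (hV : V.PosDef) : (V ^ 2).PosDef := by
  refine (hV.posSemidef.pow 2).posDef_iff_det_ne_zero.2 ?_
  rw [Matrix.det_pow]
  exact pow_ne_zero _ hV.det_pos.ne'

theorem sqrt_sq_of_posDef {V : Matrix (Fin p) (Fin p) ℝ} (hV : V.PosDef) :
    CFC.sqrt (V ^ 2) = V :=
  ((eq_sqrt_iff (posDef_sq hV)).2 ⟨hV, rfl⟩).symm

/-- Injectivity here, and surjectivity in `image_sqUpper`, are the uniqueness and existence of the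
positive definite square root. -/
theorem injOn_sqUpper : Set.InjOn (sqUpper (p := p)) {x | (symOfUpper p x).PosDef} := by
  intro x hx y hy h
  have h' : symOfUpper p x ^ 2 = symOfUpper p y ^ 2 := by
    rw [← symOfUpper_sqUpper, ← symOfUpper_sqUpper, h]
  have : symOfUpper p x = symOfUpper p y := by
    rw [← sqrt_sq_of_posDef hx, ← sqrt_sq_of_posDef hy, h']
  rw [← upper_symOfUpper x, this, upper_symOfUpper]

theorem image_sqUpper : sqUpper (p := p) '' {x | (symOfUpper p x).PosDef} =
    {x | (symOfUpper p x).PosDef} := by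
  ext x
  constructor
  · rintro ⟨y, hy, rfl⟩
    change (symOfUpper p (sqUpper y)).PosDef
    rw [symOfUpper_sqUpper]
    exact posDef_sq hy
  · intro hx
    obtain ⟨hV, hsq⟩ := (eq_sqrt_iff hx).1 rfl
    have hsymm : (CFC.sqrt (symOfUpper p x)).IsSymm := by simpa using hV.isHermitian
    refine ⟨upper p (CFC.sqrt (symOfUpper p x)), ?_, ?_⟩
    · change (symOfUpper p _).PosDef
      rwa [symOfUpper_upper hsymm]
    · rw [sqUpper, symOfUpper_upper hsymm, hsq, upper_symOfUpper]

theorem measurableSet_posDef_symOfUpper :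
    MeasurableSet {x : {ij : Fin p × Fin p // ij.1 ≤ ij.2} → ℝ | (symOfUpper p x).PosDef} :=
  continuous_symOfUpper.measurable (measurableSet_posDef p)

theorem lintegral_sqUpper (g : ({ij : Fin p × Fin p // ij.1 ≤ ij.2} → ℝ) → ENNReal) :
    ∫⁻ x in {x | (symOfUpper p x).PosDef}, g x = ∫⁻ x in {x | (symOfUpper p x).PosDef},
      ENNReal.ofReal |(lyapunov (symOfUpper p x)).det| * g (sqUpper x) := by
  have := lintegral_image_eq_lintegral_abs_det_fderiv_mul volume measurableSet_posDef_symOfUpper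
    (fun x _ ↦ (hasFDerivAt_sqUpper x).hasFDerivWithinAt) (injOn_sqUpper (p := p)) g
  rwa [image_sqUpper] at this

end Lyapunov

/-! ### Assembling the density of the square root. -/

section Final

variable {p m : ℕ} {S : Matrix (Fin p) (Fin p) ℝ}

/-- The factor (2π)^(-mp/2) of the m Gaussian densities cancels π^(mp/2) in `gramConst` and leaves
2^(-mp/2). -/
theorem gramConst_mul_gaussianConst (hS : S.PosDef) :
    gramConst p m * ((√(2 * Real.pi))⁻¹ ^ p * (√S.det)⁻¹) ^ m =
      1 / ((2 : ℝ) ^ ((m : ℝ) * (p : ℝ) / 2) * multivariateGamma p ((m : ℝ) / 2) *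
          S.det ^ ((m : ℝ) / 2)) := by
  have hd := hS.det_pos
  have h1 : √S.det ^ m = S.det ^ ((m : ℝ) / 2) := by
    rw [Real.sqrt_eq_rpow, ← Real.rpow_natCast, ← Real.rpow_mul hd.le]
    congr 1; ring
  have h2 : (√(2 * Real.pi) ^ p) ^ m =
      (2 : ℝ) ^ ((m : ℝ) * (p : ℝ) / 2) * Real.pi ^ ((m : ℝ) * (p : ℝ) / 2) := by
    rw [← Real.mul_rpow zero_le_two Real.pi_pos.le, Real.sqrt_eq_rpow, ← pow_mul,
      ← Real.rpow_natCast, ← Real.rpow_mul (by positivity)]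
    congr 1; push_cast; ring
  have hpi := Real.rpow_pos_of_pos Real.pi_pos ((m : ℝ) * (p : ℝ) / 2)
  rw [gramConst, mul_pow, inv_pow, inv_pow, inv_pow, h1, h2]
  field_simp

theorem sqrtDensity_of_posDef (hpm : p ≤ m) (hS : S.PosDef) {V : Matrix (Fin p) (Fin p) ℝ}
    (hV : V.PosDef) : ENNReal.ofReal (sqrtDensity p m S V) =
      ENNReal.ofReal (gramConst p m) * (ENNReal.ofReal |(lyapunov V).det| *
        (detPow (((m : ℝ) - p - 1) / 2) (V ^ 2) * ENNReal.ofReal (wishartDensity m S (V ^ 2)))) := by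
  have hd := hV.det_pos
  have hprod : 0 ≤ ∏ ij : Fin p × Fin p with ij.1 < ij.2,
      (hV.isHermitian.eigenvalues ij.1 + hV.isHermitian.eigenvalues ij.2) :=
    Finset.prod_nonneg fun ij _ ↦ add_nonneg (hV.eigenvalues_pos _).le (hV.eigenvalues_pos _).le
  -- The extra factor |V| is the one in the Jacobian `det_lyapunov`.
  have hpow : (V ^ 2).det ^ (((m : ℝ) - p - 1) / 2) * V.det = V.det ^ ((m : ℝ) - p) := by
    rw [Matrix.det_pow, ← Real.rpow_natCast, ← Real.rpow_mul hd.le]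
    nth_rewrite 2 [← Real.rpow_one V.det]
    rw [← Real.rpow_add hd]
    congr 1; push_cast; ring
  rw [detPow, if_pos (posDef_sq hV), det_lyapunov hV.isHermitian,
    abs_of_nonneg (mul_nonneg (by positivity) hprod),
    ← ENNReal.ofReal_mul (Real.rpow_nonneg (posDef_sq hV).det_pos.le _),
    ← ENNReal.ofReal_mul (mul_nonneg (by positivity) hprod),
    ← ENNReal.ofReal_mul (gramConst_pos hpm).le, sqrtDensity, dif_pos hV, wishartDensity, ← hpow,
    div_eq_mul_one_div, ← gramConst_mul_gaussianConst hS]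
  congr 1
  ring

theorem sqrtDensity_of_not_posDef {V : Matrix (Fin p) (Fin p) ℝ} (hV : ¬ V.PosDef) :
    sqrtDensity p m S V = 0 := dif_neg hV

/-- The eigenvalue product is not treated directly: on the cone it is absorbed in the Jacobian
determinant of squaring, and determinants of derivatives are a.e. measurable. -/
theorem aemeasurable_sqrtDensity (hpm : p ≤ m) (hS : S.PosDef) :
    AEMeasurable (fun V ↦ ENNReal.ofReal (sqrtDensity p m S V)) (symLebesgue p) := by
  rw [symLebesgue, measurableEmbedding_symOfUpper.aemeasurable_map_iff]
  have hind : (fun V ↦ ENNReal.ofReal (sqrtDensity p m S V)) ∘ symOfUpper p =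
      {x | (symOfUpper p x).PosDef}.indicator fun x ↦
        ENNReal.ofReal (gramConst p m) * (ENNReal.ofReal |(lyapunov (symOfUpper p x)).det| *
          (detPow (((m : ℝ) - p - 1) / 2) (symOfUpper p x ^ 2) *
            ENNReal.ofReal (wishartDensity m S (symOfUpper p x ^ 2)))) := by
    funext x
    by_cases hx : (symOfUpper p x).PosDef
    · rw [Set.indicator_of_mem (by exact hx), Function.comp_apply, sqrtDensity_of_posDef hpm hS hx]
    · rw [Set.indicator_of_notMem (by exact hx), Function.comp_apply, sqrtDensity_of_not_posDef hx,
        ENNReal.ofReal_zero]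
  have hsq : Measurable fun x ↦ symOfUpper p x ^ 2 := by
    simp only [sq]
    exact (continuous_symOfUpper.matrix_mul continuous_symOfUpper).measurable
  rw [hind, aemeasurable_indicator_iff measurableSet_posDef_symOfUpper]
  refine AEMeasurable.const_mul (AEMeasurable.mul ?_ (Measurable.aemeasurable ?_)) _
  · exact aemeasurable_ofReal_abs_det_fderivWithin volume measurableSet_posDef_symOfUpper
      fun x _ ↦ (hasFDerivAt_sqUpper x).hasFDerivWithinAt
  · exact ((measurable_detPow _).comp hsq).mul
      ((measurable_wishartDensity m S).comp hsq).ennreal_ofReal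

theorem ae_posDef_wishart (hpm : p ≤ m) (hS : S.PosDef) : ∀ᵐ W ∂wishart p m S, W.PosDef := by
  have hm : Measurable ({W : Matrix (Fin p) (Fin p) ℝ | W.PosDef}ᶜ.indicator
      (1 : Matrix (Fin p) (Fin p) ℝ → ENNReal)) :=
    measurable_one.indicator (measurableSet_posDef p).compl
  have h0 := lintegral_wishart hpm hS hm
  have h1 (v) : detPow (((m : ℝ) - p - 1) / 2) (symOfUpper p v) *
      (ENNReal.ofReal (wishartDensity m S (symOfUpper p v)) *
        {W | W.PosDef}ᶜ.indicator 1 (symOfUpper p v)) = 0 := by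
    by_cases h : (symOfUpper p v).PosDef <;> simp [detPow, h]
  simp only [h1, lintegral_zero, mul_zero] at h0
  filter_upwards [(lintegral_eq_zero_iff hm).1 h0] with W hW
  by_contra h
  simp [h] at hW

open Classical in
/-- The symmetric square root of positive definite matrices, extended by zero. -/
noncomputable def posDefSqrt (W : Matrix (Fin p) (Fin p) ℝ) : Matrix (Fin p) (Fin p) ℝ :=
  if W.PosDef then CFC.sqrt W else 0

theorem posDefSqrt_of_posDef {W : Matrix (Fin p) (Fin p) ℝ} (hW : W.PosDef) :
    posDefSqrt W = CFC.sqrt W := if_pos hW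

-- Continuity of the square root is a C⋆-algebra fact, hence the operator norm.
open Matrix.Norms.L2Operator in
theorem continuousOn_sqrt :
    ContinuousOn (CFC.sqrt : Matrix (Fin p) (Fin p) ℝ → _) {W | W.PosDef} :=
  CFC.continuousOn_sqrt.mono fun _ hW ↦ Matrix.PosSemidef.nonneg (Matrix.PosDef.posSemidef hW)

theorem measurable_posDefSqrt : Measurable (posDefSqrt (p := p)) := by
  classical
  exact continuousOn_sqrt.measurable_piecewise continuousOn_const (measurableSet_posDef p)

/-- The law of the symmetric square root of a Wishart matrix. -/
theorem map_posDefSqrt_wishart (hpm : p ≤ m) (hS : S.PosDef) :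
    (wishart p m S).map posDefSqrt =
      (symLebesgue p).withDensity fun V ↦ ENNReal.ofReal (sqrtDensity p m S V) := by
  ext B hB
  set PD : Set ({ij : Fin p × Fin p // ij.1 ≤ ij.2} → ℝ) := {x | (symOfUpper p x).PosDef}
  have hPD : MeasurableSet PD := measurableSet_posDef_symOfUpper
  have hind : Measurable fun W ↦ B.indicator (1 : Matrix (Fin p) (Fin p) ℝ → ENNReal) (posDefSqrt (p := p) W) :=
    (measurable_one.indicator hB).comp measurable_posDefSqrt
  have h1 : ∀ v ∉ PD, detPow (((m : ℝ) - p - 1) / 2) (symOfUpper p v) *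
      (ENNReal.ofReal (wishartDensity m S (symOfUpper p v)) *
        B.indicator 1 (posDefSqrt (symOfUpper p v))) = 0 := fun v hv ↦ by
    rw [detPow, if_neg (show ¬ (symOfUpper p v).PosDef from hv), zero_mul]
  have h2 : ∀ v ∉ PD, B.indicator (fun V ↦ ENNReal.ofReal (sqrtDensity p m S V))
      (symOfUpper p v) = 0 := fun v hv ↦ by
    simp [sqrtDensity_of_not_posDef (m := m) (S := S) hv]
  -- Both integrands vanish off the cone, so both integrals restrict to it; the substitution W = V²
  -- is then made on the Wishart side.
  rw [withDensity_apply _ hB, ← lintegral_indicator hB, symLebesgue,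
    measurableEmbedding_symOfUpper.lintegral_map, ← lintegral_indicator_one hB,
    lintegral_map (measurable_one.indicator hB) measurable_posDefSqrt, lintegral_wishart hpm hS hind,
    ← setLIntegral_eq_of_support_subset (Function.support_subset_iff'.2 h1),
    ← setLIntegral_eq_of_support_subset (Function.support_subset_iff'.2 h2), lintegral_sqUpper,
    ← lintegral_const_mul' _ _ ENNReal.ofReal_ne_top]
  refine setLIntegral_congr_fun hPD fun x (hx : (symOfUpper p x).PosDef) ↦ ?_
  simp only [symOfUpper_sqUpper, posDefSqrt_of_posDef (posDef_sq hx), sqrt_sq_of_posDef hx]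
  by_cases hxB : symOfUpper p x ∈ B
  · simp only [Set.indicator_of_mem hxB, sqrtDensity_of_posDef hpm hS hx, Pi.one_apply, mul_one]
  · simp only [Set.indicator_of_notMem hxB, mul_zero]

end Final

end WishartSqrt

theorem mainTheorem1 {Ω : Type*} [MeasurableSpace Ω] (P : Measure Ω) [IsProbabilityMeasure P]
    (p m : ℕ) (hpm : p ≤ m) (S : Matrix (Fin p) (Fin p) ℝ) (hS : S.PosDef)
    (W V : Ω → Matrix (Fin p) (Fin p) ℝ)
    (hW : HasLaw W (WishartSqrt.wishart p m S) P)
    (hV : ∀ ω, V ω = CFC.sqrt (W ω)) :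
    HasPDF V P (WishartSqrt.symLebesgue p) ∧
      pdf V P (WishartSqrt.symLebesgue p) =ᵐ[WishartSqrt.symLebesgue p]
        fun A => ENNReal.ofReal (WishartSqrt.sqrtDensity p m S A) := by
  -- W is almost surely positive definite, so V may be replaced by a Borel function of W.
  have hae : V =ᵐ[P] WishartSqrt.posDefSqrt ∘ W := by
    have h : ∀ᵐ A ∂P.map W, A.PosDef := hW.map_eq ▸ WishartSqrt.ae_posDef_wishart hpm hS
    filter_upwards [ae_of_ae_map hW.aemeasurable h] with ω hω
    rw [hV, Function.comp_apply, WishartSqrt.posDefSqrt_of_posDef hω]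
  have hVm : AEMeasurable V P :=
    (WishartSqrt.measurable_posDefSqrt.comp_aemeasurable hW.aemeasurable).congr hae.symm
  have hmap : P.map V = (WishartSqrt.symLebesgue p).withDensity
      fun A ↦ ENNReal.ofReal (WishartSqrt.sqrtDensity p m S A) := by
    rw [Measure.map_congr hae, ← AEMeasurable.map_map_of_aemeasurable
      WishartSqrt.measurable_posDefSqrt.aemeasurable hW.aemeasurable, hW.map_eq,
      WishartSqrt.map_posDefSqrt_wishart hpm hS]
  have hd := WishartSqrt.aemeasurable_sqrtDensity hpm hS
  have hpdf := hasPDF_of_map_eq_withDensity hVm _ hd hmap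
  exact ⟨hpdf, (pdf.eq_of_map_eq_withDensity _ hd).1 hmap⟩
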